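/- Let $\Gamma=(I,H)$ be a quiver with finitely many vertices and arrows; an arrow $h\in H$ goes from $h'$ to $h''$. All representations are finite dimensional and over $\mathbb{C}$; dimension vectors are families of non-negative integers indexed by $I$. For $a,b\in\mathbb{Z}^I$ put $$\langle a,b\rangle=\sum_{i\in I}a_ib_i-\sum_{h\in H}a_{h'}b_{h''}.$$ Fix an integer $d>0$. A flag type for a representation $\mathbf V$ is a $d$-tuple $\mathbf v=(\mathbf v_1,\dots,\mathbf v_d)$ of dimension vectors with $\mathbf v_1\le\dots\le\mathbf v_d=\dim\mathbf V$ (componentwise). Let $\mathcal F_{\mathbf v}(\mathbf V)$ be the set of chains of subrepresentations $\mathbf V^1\subset\dots\subset\mathbf V^d=\mathbf V$ with $\dim\mathbf V^r=\mathbf v_r$ for all $r$; it is a (reduced, possibly empty) projective variety, a closed subset of the product of the Grassmannians of $\mathbf v_{r,i}$-dimensional subspaces of $\mathbf V_i$. Put $\overline{\mathbf v}_1=\mathbf v_1$ and $\overline{\mathbf v}_r=\mathbf v_r-\mathbf v_{r-1}$ for $2\le r\le d$. Let $0\to\mathbf V\to\mathbf U\xrightarrow{\pi}\mathbf W\to0$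 be a short exact sequence of representations of $\Gamma$, and let $\mathbf v$, $\mathbf w$ be flag types for $\mathbf V$, $\mathbf W$. For a flag $\phi$ in $\mathbf U$ let $\phi\cap\mathbf V$ and $\pi(\phi)$ be the families of the intersections with $\mathbf V$, respectively of the images in $\mathbf W$, of the members of $\phi$. Let $$\mathcal F_{\mathbf v,\mathbf w}(\mathbf U)=\{\phi\in\mathcal F_{\mathbf v+\mathbf w}(\mathbf U)\;:\;\phi\cap\mathbf V\in\mathcal F_{\mathbf v}(\mathbf V)\},$$ with its structure of a (reduced) locally closed subvariety of a product of Grassmannians; for $\phi$ in this set one has $\pi(\phi)\in\mathcal F_{\mathbf w}(\mathbf W)$. Assume that $\mathrm{Ext}^1_\Gamma(\mathbf W,\mathbf V)=0$. Then the map $$\mathcal F_{\mathbf v,\mathbf w}(\mathbf U)\to\mathcal F_{\mathbf v}(\mathbf V)\times\mathcal F_{\mathbf w}(\mathbf W),\qquad \phi\mapsto(\phi\cap\mathbf V,\pi(\phi)),$$ is a (Zariski locally trivial, algebraic) vector bundle of rank $$\sum_{r=1}^{d-1}\sum_{t=r+1}^{d}\langle\overline{\mathbf w}_r,\overline{\mathbf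 v}_t\rangle .$$ -/

import Mathlib

open CategoryTheory Filter Topology

universe u v w

/-! ### Varieties as spaces with functions -/

/-- A space with functions over `ℂ`: a topological space together with, for every point `x`, the
algebra of those complex valued functions that are regular at `x` (the values of a function away
from `x` are irrelevant). Regularity is a local and open condition, regular functions have open
non-vanishing loci, and a regular function that does not vanish at `x` is invertible at `x`. -/
structure SpaceWithFunctions (X : Type*) extends TopologicalSpace X where
  regularAt : X → Subalgebra ℂ (X → ℂ)
  congr : ∀ (x : X) (f g : X → ℂ), f =ᶠ[𝓝 x] g → f ∈ regularAt x → g ∈ regularAt x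
  eventually_regular : ∀ (x : X) (f : X → ℂ), f ∈ regularAt x → ∀ᶠ y in 𝓝 x, f ∈ regularAt y
  eventually_ne : ∀ (x : X) (f : X → ℂ), f ∈ regularAt x → f x ≠ 0 → ∀ᶠ y in 𝓝 x, f y ≠ 0
  inv_mem : ∀ (x : X) (f : X → ℂ), f ∈ regularAt x → f x ≠ 0 → f⁻¹ ∈ regularAt x

namespace SpaceWithFunctions

/-- The neighbourhood filter of a space with functions. -/
def nhds {X : Type*} (S : SpaceWithFunctions X) (x : X) : Filter X :=
  @_root_.nhds X S.toTopologicalSpace x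

/-- The open sets of a space with functions. -/
def IsOpenSet {X : Type*} (S : SpaceWithFunctions X) (O : Set X) : Prop :=
  @IsOpen X S.toTopologicalSpace O

/-- A morphism: a continuous map that pulls regular functions back to regular functions. -/
def IsMorphism {X Y : Type*} (S : SpaceWithFunctions X) (T : SpaceWithFunctions Y)
    (f : X → Y) : Prop :=
  @Continuous X Y S.toTopologicalSpace T.toTopologicalSpace f ∧
    ∀ (x : X) (g : Y → ℂ), g ∈ T.regularAt (f x) → g ∘ f ∈ S.regularAt x

/-- An isomorphism: a bijective morphism whose inverse is a morphism. -/
def IsIsomorphism {X Y : Type*} (S : SpaceWithFunctions X) (T : SpaceWithFunctions Y)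
    (e : X ≃ Y) : Prop :=
  S.IsMorphism T e ∧ T.IsMorphism S e.symm

section Fractions

variable {X : Type*} [TopologicalSpace X] (A : X → Subalgebra ℂ (X → ℂ))

/-- `P` holds at all points near `x` at which a suitable `h` in `A x` with `h x ≠ 0` does not
vanish. -/
def NearBy (x : X) (P : X → Prop) : Prop :=
  ∃ h ∈ A x, h x ≠ 0 ∧ ∀ᶠ y in 𝓝 x, h y ≠ 0 → P y

theorem NearBy.of_forall {x : X} {P : X → Prop} (h : ∀ y, P y) : NearBy A x P :=
  ⟨1, one_mem _, one_ne_zero, Eventually.of_forall fun y _ => h y⟩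

theorem NearBy.mono {x : X} {P Q : X → Prop} (h : ∀ y, P y → Q y) (hP : NearBy A x P) :
    NearBy A x Q := by
  obtain ⟨k, hk, hx, hn⟩ := hP
  exact ⟨k, hk, hx, hn.mono fun y hy hy' => h y (hy hy')⟩

theorem NearBy.and {x : X} {P Q : X → Prop} (hP : NearBy A x P) (hQ : NearBy A x Q) :
    NearBy A x (fun y => P y ∧ Q y) := by
  obtain ⟨k, hk, hx, hn⟩ := hP
  obtain ⟨l, hl, lx, ln⟩ := hQ
  refine ⟨k * l, mul_mem hk hl, mul_ne_zero hx lx, ?_⟩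
  filter_upwards [hn, ln] with y h1 h2 h3
  exact ⟨h1 (left_ne_zero_of_mul h3), h2 (right_ne_zero_of_mul h3)⟩

theorem NearBy.self {x : X} {P : X → Prop} (hP : NearBy A x P) : P x := by
  obtain ⟨k, _, hx, hn⟩ := hP
  exact hn.self_of_nhds hx

theorem NearBy.nearBy
    (hA : ∀ (x : X) (f : X → ℂ), f ∈ A x → ∀ᶠ y in 𝓝 x, f ∈ A y)
    {x : X} {P : X → Prop} (hP : NearBy A x P) :
    NearBy A x (fun y => NearBy A y P) := by
  obtain ⟨k, hk, hx, hn⟩ := hP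
  refine ⟨k, hk, hx, ?_⟩
  filter_upwards [hn.eventually_nhds, hA x k hk] with y h1 h2 h3
  exact ⟨k, h2, h3, h1⟩

/-- The topology with basis the loci, inside an open set on which `h` belongs to `A`, where `h`
does not vanish. -/
@[reducible] def fractionsTopology : TopologicalSpace X where
  IsOpen O := ∀ x ∈ O, NearBy A x (fun y => y ∈ O)
  isOpen_univ := fun _ _ => NearBy.of_forall A fun _ => Set.mem_univ _
  isOpen_inter := fun _ _ hs ht x hx => (hs x hx.1).and A (ht x hx.2)
  isOpen_sUnion := fun _ h x ⟨t, ht, hx⟩ =>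
    (h t ht x hx).mono A fun _ hy => ⟨t, ht, hy⟩

theorem eventually_fractionsTopology
    (hA : ∀ (x : X) (f : X → ℂ), f ∈ A x → ∀ᶠ y in 𝓝 x, f ∈ A y)
    {x : X} {P : X → Prop} :
    (∀ᶠ y in @_root_.nhds X (fractionsTopology A) x, P y) ↔ NearBy A x P := by
  constructor
  · intro h
    obtain ⟨t, ht, hto, hxt⟩ := (@eventually_nhds_iff X (fractionsTopology A) x P).1 h
    exact NearBy.mono A ht (hto x hxt)
  · intro h
    refine (@eventually_nhds_iff X (fractionsTopology A) x P).2
      ⟨{y | NearBy A y P}, fun y hy => NearBy.self A hy, fun y hy => ?_, h⟩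
    exact NearBy.nearBy A hA hy

/-- The space with functions whose regular functions are locally fractions `g / h` with `g`, `h`
in `A` and `h` non-vanishing. -/
noncomputable def ofFractions
    (hA : ∀ (x : X) (f : X → ℂ), f ∈ A x → ∀ᶠ y in 𝓝 x, f ∈ A y) :
    SpaceWithFunctions X where
  toTopologicalSpace := fractionsTopology A
  regularAt x :=
    { carrier := {f | ∃ g ∈ A x, ∃ h ∈ A x, h x ≠ 0 ∧ NearBy A x (fun y => f y = g y / h y)}
      mul_mem' := by
        rintro f f' ⟨g, hg, h, hh, hx, hn⟩ ⟨g', hg', h', hh', hx', hn'⟩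
        refine ⟨g * g', mul_mem hg hg', h * h', mul_mem hh hh', mul_ne_zero hx hx', ?_⟩
        refine (hn.and A hn').mono A ?_
        rintro y ⟨h1, h2⟩
        simp only [Pi.mul_apply, h1, h2]
        rw [div_mul_div_comm]
      add_mem' := by
        rintro f f' ⟨g, hg, h, hh, hx, hn⟩ ⟨g', hg', h', hh', hx', hn'⟩
        refine ⟨g * h' + h * g', add_mem (mul_mem hg hh') (mul_mem hh hg'), h * h',
          mul_mem hh hh', mul_ne_zero hx hx', ?_⟩
        have h0 : NearBy A x (fun y => (h * h') y ≠ 0) :=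
          ⟨h * h', mul_mem hh hh', mul_ne_zero hx hx', Eventually.of_forall fun y hy => hy⟩
        refine ((hn.and A hn').and A h0).mono A ?_
        rintro y ⟨⟨h1, h2⟩, h3⟩
        simp only [Pi.add_apply, Pi.mul_apply, h1, h2]
        rw [div_add_div _ _ (left_ne_zero_of_mul h3) (right_ne_zero_of_mul h3)]
      algebraMap_mem' := by
        intro c
        refine ⟨algebraMap ℂ (X → ℂ) c, algebraMap_mem _ c, 1, one_mem _, one_ne_zero, ?_⟩
        exact NearBy.of_forall A fun y => by simp }
  congr := by
    rintro x f f' hff ⟨g, hg, h, hh, hx, hn⟩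
    refine ⟨g, hg, h, hh, hx, ?_⟩
    refine (((eventually_fractionsTopology A hA).1 hff).and A hn).mono A ?_
    rintro y ⟨h1, h2⟩
    exact h1.symm.trans h2
  eventually_regular := by
    rintro x f ⟨g, hg, h, hh, hx, hn⟩
    rw [eventually_fractionsTopology A hA]
    have h0 : NearBy A x (fun y => h y ≠ 0) :=
      ⟨h, hh, hx, Eventually.of_forall fun y hy => hy⟩
    have h1 : NearBy A x (fun y => g ∈ A y ∧ h ∈ A y) :=
      ⟨1, one_mem _, one_ne_zero, ((hA x g hg).and (hA x h hh)).mono fun y hy _ => hy⟩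
    refine ((NearBy.nearBy A hA hn).and A (h0.and A h1)).mono A ?_
    rintro y ⟨h2, h3, h4, h5⟩
    exact ⟨g, h4, h, h5, h3, h2⟩
  eventually_ne := by
    rintro x f ⟨g, hg, h, hh, hx, hn⟩ hfx
    rw [eventually_fractionsTopology A hA]
    have hgx : g x ≠ 0 := by
      intro h0
      apply hfx
      rw [hn.self A, h0, zero_div]
    have h0 : NearBy A x (fun y => h y ≠ 0) :=
      ⟨h, hh, hx, Eventually.of_forall fun y hy => hy⟩
    have h1 : NearBy A x (fun y => g y ≠ 0) :=
      ⟨g, hg, hgx, Eventually.of_forall fun y hy => hy⟩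
    refine (hn.and A (h0.and A h1)).mono A ?_
    rintro y ⟨h2, h3, h4⟩
    rw [h2]
    exact div_ne_zero h4 h3
  inv_mem := by
    rintro x f ⟨g, hg, h, hh, hx, hn⟩ hfx
    have hgx : g x ≠ 0 := by
      intro h0
      apply hfx
      rw [hn.self A, h0, zero_div]
    refine ⟨h, hh, g, hg, hgx, hn.mono A ?_⟩
    intro y hy
    rw [Pi.inv_apply, hy, inv_div]

end Fractions

/-- The polynomial functions on a complex vector space. -/
def polynomialFunctions (E : Type*) [AddCommGroup E] [Module ℂ E] : Subalgebra ℂ (E → ℂ) :=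
  Algebra.adjoin ℂ (Set.range fun l : Module.Dual ℂ E => (l : E → ℂ))

/-- A finite dimensional complex vector space as an affine space: Zariski topology, and regular
functions that are locally quotients of polynomials. (The auxiliary topology is the trivial
one.) -/
noncomputable def affine (E : Type*) [AddCommGroup E] [Module ℂ E] : SpaceWithFunctions E :=
  @ofFractions E ⊤ (fun _ => polynomialFunctions E)
    (fun _ _ hf => @Eventually.of_forall E _ (@_root_.nhds E ⊤ _) fun _ => hf)

/-- The functions of the form `(x, y) ↦ ∑ aₖ x * bₖ y` (finite sums) with all `aₖ` regular at the
first and all `bₖ` regular at the second coordinate of the given point. -/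
def tensorAt {X Y : Type*} (S : SpaceWithFunctions X) (T : SpaceWithFunctions Y) (p : X × Y) :
    Subalgebra ℂ (X × Y → ℂ) :=
  Algebra.adjoin ℂ
    ((fun (a : X → ℂ) (q : X × Y) => a q.1) '' (S.regularAt p.1 : Set (X → ℂ)) ∪
      (fun (b : Y → ℂ) (q : X × Y) => b q.2) '' (T.regularAt p.2 : Set (Y → ℂ)))

theorem eventually_tensorAt {X Y : Type*} (S : SpaceWithFunctions X) (T : SpaceWithFunctions Y)
    (p : X × Y) (f : X × Y → ℂ) (hf : f ∈ tensorAt S T p) :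
    ∀ᶠ q in @_root_.nhds (X × Y)
      (@instTopologicalSpaceProd X Y S.toTopologicalSpace T.toTopologicalSpace) p,
      f ∈ tensorAt S T q := by
  let _ := S.toTopologicalSpace
  let _ := T.toTopologicalSpace
  unfold tensorAt at hf
  induction hf using Algebra.adjoin_induction with
  | mem f hf =>
    rcases hf with ⟨a, ha, rfl⟩ | ⟨b, hb, rfl⟩
    · have h1 := (continuous_fst.continuousAt (x := p)).eventually
        (S.eventually_regular p.1 a ha)
      exact h1.mono fun q hq => Algebra.subset_adjoin (Or.inl ⟨a, hq, rfl⟩)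
    · have h1 := (continuous_snd.continuousAt (x := p)).eventually
        (T.eventually_regular p.2 b hb)
      exact h1.mono fun q hq => Algebra.subset_adjoin (Or.inr ⟨b, hq, rfl⟩)
  | algebraMap c => exact Eventually.of_forall fun q => algebraMap_mem _ c
  | add f g _ _ h1 h2 =>
    filter_upwards [h1, h2] with q a b
    exact add_mem a b
  | mul f g _ _ h1 h2 =>
    filter_upwards [h1, h2] with q a b
    exact mul_mem a b

/-- The product of two varieties: the sets where `∑ aₖ ⊗ bₖ` does not vanish, inside products of
open sets on which the `aₖ` and the `bₖ` are regular, form a basis of the topology, and regular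
functions are locally quotients of such sums. -/
noncomputable def prod {X Y : Type*} (S : SpaceWithFunctions X) (T : SpaceWithFunctions Y) :
    SpaceWithFunctions (X × Y) :=
  @ofFractions (X × Y)
    (@instTopologicalSpaceProd X Y S.toTopologicalSpace T.toTopologicalSpace)
    (tensorAt S T) (eventually_tensorAt S T)

/-- The structure induced on a subset: induced topology, and regular functions that locally extend
to regular functions on the ambient space. -/
def restrict {X : Type*} (S : SpaceWithFunctions X) (Z : Set X) : SpaceWithFunctions Z where
  toTopologicalSpace := @instTopologicalSpaceSubtype X (fun x => x ∈ Z) S.toTopologicalSpace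
  regularAt z :=
    letI := S.toTopologicalSpace
    { carrier := {f | ∃ g ∈ S.regularAt z, ∀ᶠ y in 𝓝 z, f y = g y}
      mul_mem' := by
        rintro f f' ⟨g, hg, h⟩ ⟨g', hg', h'⟩
        refine ⟨g * g', mul_mem hg hg', ?_⟩
        filter_upwards [h, h'] with y h1 h2
        simp [h1, h2]
      add_mem' := by
        rintro f f' ⟨g, hg, h⟩ ⟨g', hg', h'⟩
        refine ⟨g + g', add_mem hg hg', ?_⟩
        filter_upwards [h, h'] with y h1 h2
        simp [h1, h2]
      algebraMap_mem' := fun c =>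
        ⟨algebraMap ℂ _ c, algebraMap_mem _ c, Eventually.of_forall fun y => by simp⟩ }
  congr := by
    let _ := S.toTopologicalSpace
    rintro x f f' hff ⟨g, hg, h⟩
    refine ⟨g, hg, ?_⟩
    filter_upwards [hff, h] with y h1 h2
    exact h1.symm.trans h2
  eventually_regular := by
    let _ := S.toTopologicalSpace
    rintro x f ⟨g, hg, h⟩
    have h1 := (continuous_subtype_val.continuousAt (x := x)).eventually
      (S.eventually_regular x g hg)
    filter_upwards [h1, h.eventually_nhds] with y h2 h3
    exact ⟨g, h2, h3⟩
  eventually_ne := by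
    let _ := S.toTopologicalSpace
    rintro x f ⟨g, hg, h⟩ hx
    have hgx : g x ≠ 0 := by rwa [← h.self_of_nhds]
    have h1 := (continuous_subtype_val.continuousAt (x := x)).eventually
      (S.eventually_ne x g hg hgx)
    filter_upwards [h1, h] with y h2 h3
    rwa [h3]
  inv_mem := by
    let _ := S.toTopologicalSpace
    rintro x f ⟨g, hg, h⟩ hx
    have hgx : g x ≠ 0 := by rwa [← h.self_of_nhds]
    exact ⟨g⁻¹, S.inv_mem x g hg hgx, h.mono fun y hy => by simp [hy]⟩

/-- The quotient structure along a map `q`: a set is open if its preimage is, and a function is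
regular if its pullback is regular. -/
def quotient {X Y : Type*} (S : SpaceWithFunctions Y) (q : Y → X) : SpaceWithFunctions X where
  toTopologicalSpace := TopologicalSpace.coinduced q S.toTopologicalSpace
  regularAt x :=
    letI := TopologicalSpace.coinduced q S.toTopologicalSpace
    { carrier := {f | ∀ᶠ x' in 𝓝 x, ∀ y, q y = x' → f ∘ q ∈ S.regularAt y}
      mul_mem' := by
        intro f f' h h'
        filter_upwards [h, h'] with x' h1 h2 y hy
        exact mul_mem (h1 y hy) (h2 y hy)
      add_mem' := by
        intro f f' h h'
        filter_upwards [h, h'] with x' h1 h2 y hy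
        exact add_mem (h1 y hy) (h2 y hy)
      algebraMap_mem' := fun c => Eventually.of_forall fun x' y _ =>
        algebraMap_mem (S.regularAt y) c }
  congr := by
    let _ := TopologicalSpace.coinduced q S.toTopologicalSpace
    let _ := S.toTopologicalSpace
    intro x f f' hff h
    filter_upwards [hff.eventually_nhds, h] with x' h1 h2 y hy
    subst hy
    refine S.congr y _ _ ?_ (h2 y rfl)
    exact (continuous_coinduced_rng (f := q)).continuousAt.eventually h1
  eventually_regular := by
    let _ := TopologicalSpace.coinduced q S.toTopologicalSpace
    intro x f h
    exact h.eventually_nhds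
  eventually_ne := by
    let _ := TopologicalSpace.coinduced q S.toTopologicalSpace
    let _ := S.toTopologicalSpace
    intro x f h hx
    obtain ⟨O, hO, hOo, hxO⟩ := eventually_nhds_iff.1 h
    refine eventually_nhds_iff.2 ⟨{z | z ∈ O ∧ f z ≠ 0}, fun z hz => hz.2, ?_, hxO, hx⟩
    rw [isOpen_coinduced, isOpen_iff_mem_nhds]
    rintro y ⟨hy1, hy2⟩
    have h1 := S.eventually_ne y _ (hO (q y) hy1 y rfl) hy2
    have h2 : ∀ᶠ z in 𝓝 y, q z ∈ O := (isOpen_coinduced.1 hOo).mem_nhds hy1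
    filter_upwards [h1, h2] with z h3 h4
    exact ⟨h4, h3⟩
  inv_mem := by
    let _ := TopologicalSpace.coinduced q S.toTopologicalSpace
    let _ := S.toTopologicalSpace
    intro x f h hx
    obtain ⟨O, hO, hOo, hxO⟩ := eventually_nhds_iff.1 h
    refine eventually_nhds_iff.2 ⟨{z | z ∈ O ∧ f z ≠ 0}, ?_, ?_, hxO, hx⟩
    · rintro z ⟨hz1, hz2⟩ y rfl
      exact S.inv_mem y _ (hO (q y) hz1 y rfl) hz2
    · rw [isOpen_coinduced, isOpen_iff_mem_nhds]
      rintro y ⟨hy1, hy2⟩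
      have h1 := S.eventually_ne y _ (hO (q y) hy1 y rfl) hy2
      have h2 : ∀ᶠ z in 𝓝 y, q z ∈ O := (isOpen_coinduced.1 hOo).mem_nhds hy1
      filter_upwards [h1, h2] with z h3 h4
      exact ⟨h4, h3⟩

end SpaceWithFunctions

/-- The morphism `p : E → B` is an algebraic vector bundle of rank `r`: its fibres carry complex
vector space structures such that `B` is covered by (Zariski) open sets `O` over which `E` is
isomorphic to `O × ℂ ^ n`, compatibly with the projections to `O` and linearly on the fibres, with
`n = r`. (The integer `r` may be negative only if `B` is empty.) -/
def IsVectorBundleOfRank {E B : Type*} (SE : SpaceWithFunctions E) (SB : SpaceWithFunctions B)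
    (p : E → B) (r : ℤ) : Prop :=
  SE.IsMorphism SB p ∧
  ∃ (_ : ∀ b : B, AddCommGroup {x : E // p x = b}) (_ : ∀ b : B, Module ℂ {x : E // p x = b}),
    ∀ b₀ : B, ∃ (O : Set B) (n : ℕ) (e : (p ⁻¹' O : Set E) ≃ O × (Fin n → ℂ)),
      b₀ ∈ O ∧ SB.IsOpenSet O ∧ (n : ℤ) = r ∧
      (SE.restrict (p ⁻¹' O)).IsIsomorphism
        ((SB.restrict O).prod (SpaceWithFunctions.affine (Fin n → ℂ))) e ∧
      (∀ x : (p ⁻¹' O : Set E), ((e x).1 : B) = p x) ∧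
      ∀ (b : B) (hb : b ∈ O), IsLinearMap ℂ fun x : {x : E // p x = b} =>
        (e ⟨x.1, show p x.1 ∈ O from x.2.symm ▸ hb⟩).2

/-! ### Products of Grassmannians -/

section Grassmannian

variable {κ : Type*} (M : κ → Type*) [∀ a, AddCommGroup (M a)] [∀ a, Module ℂ (M a)]
  (k : κ → ℕ)

/-- The points of the product over `a : κ` of the Grassmannians of `k a`-dimensional subspaces of
`M a`. -/
def MultiGrassmannian : Type _ :=
  {L : ∀ a, Submodule ℂ (M a) // ∀ a, Module.finrank ℂ (L a) = k a}

/-- Families of linearly independent `k a`-tuples in `M a`; an (open) subset of the vector space of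
all families of tuples. -/
def frames : Set (∀ a, Fin (k a) → M a) :=
  {b | ∀ a, LinearIndependent ℂ (b a)}

/-- The subspaces spanned by a family of tuples. -/
def spanFrames (b : frames M k) : MultiGrassmannian M k :=
  ⟨fun a => Submodule.span ℂ (Set.range (b.1 a)), fun a => by
    rw [finrank_span_eq_card (b.2 a), Fintype.card_fin]⟩

/-- The product of Grassmannians as a variety: the quotient of the variety of frames by the change
of frames. -/
noncomputable def MultiGrassmannian.space : SpaceWithFunctions (MultiGrassmannian M k) :=
  ((SpaceWithFunctions.affine (∀ a, Fin (k a) → M a)).restrict (frames M k)).quotient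
    (spanFrames M k)

end Grassmannian

/-! ### Quiver representations and flags -/

/-- The category of finite dimensional complex representations of a quiver. -/
abbrev QuiverRep (I : Type u) [Quiver.{v} I] := Paths I ⥤ FGModuleCat.{w} ℂ

namespace QuiverRep

variable {I : Type u} [Quiver.{v} I]

/-- The vector space at a vertex. -/
abbrev space (V : QuiverRep.{u, v, w} I) (i : I) : Type w := V.obj ((Paths.of I).obj i)

/-- The linear map along an arrow. -/
abbrev arrow (V : QuiverRep.{u, v, w} I) {i j : I} (h : i ⟶ j) :
    V.space i →ₗ[ℂ] V.space j :=
  (V.map ((Paths.of I).map h)).hom.hom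

/-- The linear map at a vertex given by a morphism of representations. -/
abbrev atVertex {V W : QuiverRep.{u, v, w} I} (f : V ⟶ W) (i : I) :
    V.space i →ₗ[ℂ] W.space i :=
  (f.app ((Paths.of I).obj i)).hom.hom

/-- `Ext¹(W, V) = 0` in the category of finite dimensional representations. -/
def ExtOneVanishes (W V : QuiverRep.{u, v, w} I) : Prop :=
  letI := HasExt.standard (QuiverRep.{u, v, w} I)
  Subsingleton (Abelian.Ext W V 1)

/-- The Euler form `⟨a, b⟩ = ∑ᵢ aᵢ bᵢ - ∑ₕ a_{source h} b_{target h}` of a finite quiver. -/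
def eulerForm (I : Type u) [Quiver.{v} I] [Fintype I] [∀ i j : I, Fintype (i ⟶ j)]
    (a b : I → ℤ) : ℤ :=
  ∑ i, a i * b i - ∑ i, ∑ j, ∑ _h : i ⟶ j, a i * b j

/-- `t = (t₁, …, t_d)` is a flag type whose weight is the dimension vector of `V`. -/
def IsFlagType (V : QuiverRep.{u, v, w} I) {d : ℕ} (t : Fin d → I → ℕ) : Prop :=
  Monotone t ∧ ∀ r : Fin d, r.val + 1 = d → ∀ i, t r i = Module.finrank ℂ (V.space i)

/-- The successive differences of a flag type: `t̄₁ = t₁` and `t̄_r = t_r - t_{r-1}`. -/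
def flagTypeStep {d : ℕ} (t : Fin d → I → ℕ) (r : Fin d) (i : I) : ℤ :=
  if r.val = 0 then (t r i : ℤ)
  else (t r i : ℤ) - (t ⟨r.val - 1, lt_of_le_of_lt (Nat.sub_le _ _) r.isLt⟩ i : ℤ)

/-- The family of subspaces `L (r, i) ⊆ V_i` is a flag of type `t` of subrepresentations of `V`. -/
structure IsFlag (V : QuiverRep.{u, v, w} I) {d : ℕ} (t : Fin d → I → ℕ)
    (L : ∀ a : Fin d × I, Submodule ℂ (V.space a.2)) : Prop where
  subrep : ∀ (r : Fin d) (i j : I) (h : i ⟶ j), (L (r, i)).map (V.arrow h) ≤ L (r, j)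
  mono : ∀ r s : Fin d, r ≤ s → ∀ i, L (r, i) ≤ L (s, i)
  last : ∀ r : Fin d, r.val + 1 = d → ∀ i, L (r, i) = ⊤
  dim : ∀ (r : Fin d) (i : I), Module.finrank ℂ (L (r, i)) = t r i

/-- The product of Grassmannians that contains the flags of type `t` in `V`. -/
abbrev FlagAmbient (V : QuiverRep.{u, v, w} I) {d : ℕ} (t : Fin d → I → ℕ) : Type _ :=
  MultiGrassmannian (fun a : Fin d × I => V.space a.2) (fun a => t a.1 a.2)

/-- The set of flags of type `t` in `V`. -/
def flags (V : QuiverRep.{u, v, w} I) {d : ℕ} (t : Fin d → I → ℕ) : Set (V.FlagAmbient t) :=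
  {φ | IsFlag V t φ.1}

/-- The variety of flags of type `t` in `V`. -/
noncomputable def flagVariety (V : QuiverRep.{u, v, w} I) {d : ℕ} (t : Fin d → I → ℕ) :
    SpaceWithFunctions (V.flags t) :=
  (MultiGrassmannian.space _ _).restrict (V.flags t)

section Extension

variable (S : ShortComplex (QuiverRep.{u, v, w} I)) {d : ℕ} (tV tW : Fin d → I → ℕ)

/-- The intersection of a family of subspaces of the middle term with the left hand term. -/
def interFamily (L : ∀ a : Fin d × I, Submodule ℂ (S.X₂.space a.2)) (a : Fin d × I) :
    Submodule ℂ (S.X₁.space a.2) :=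
  (L a).comap (atVertex S.f a.2)

/-- The image of a family of subspaces of the middle term in the right hand term. -/
def imageFamily (L : ∀ a : Fin d × I, Submodule ℂ (S.X₂.space a.2)) (a : Fin d × I) :
    Submodule ℂ (S.X₃.space a.2) :=
  (L a).map (atVertex S.g a.2)

/-- The flags of type `tV + tW` in the middle term whose intersection with the left hand term is a
flag of type `tV`. -/
def extFlags : Set (S.X₂.FlagAmbient (tV + tW)) :=
  {φ | IsFlag S.X₂ (tV + tW) φ.1 ∧ IsFlag S.X₁ tV (interFamily S φ.1)}

/-- The variety structure on `extFlags`. -/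
noncomputable def extFlagVariety : SpaceWithFunctions (extFlags S tV tW) :=
  (MultiGrassmannian.space _ _).restrict (extFlags S tV tW)

variable {S}

theorem shortExact_atVertex (hS : S.ShortExact) (i : I) :
    Function.Injective (atVertex S.f i) ∧
      Function.Exact (atVertex S.f i) (atVertex S.g i) ∧
      Function.Surjective (atVertex S.g i) := by
  have h := (hS.map_of_exact ((evaluation (Paths I) (FGModuleCat.{w} ℂ)).obj
    ((Paths.of I).obj i))).map_of_exact
      (forget₂ (FGModuleCat.{w} ℂ) (ModuleCat.{w} ℂ))
  exact ⟨h.moduleCat_injective_f,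
    (ShortComplex.ShortExact.moduleCat_exact_iff_function_exact _).1 h.exact,
    h.moduleCat_surjective_g⟩

theorem atVertex_arrow {V W : QuiverRep.{u, v, w} I} (f : V ⟶ W) {i j : I} (h : i ⟶ j)
    (x : V.space i) : atVertex f j (V.arrow h x) = W.arrow h (atVertex f i x) := by
  have h1 := f.naturality ((Paths.of I).map h)
  have h2 := congrArg (fun m => m.hom.hom x) h1
  exact h2

theorem finrank_comap_add_finrank_map {A B C : Type*} [AddCommGroup A] [Module ℂ A]
    [AddCommGroup B] [Module ℂ B] [AddCommGroup C] [Module ℂ C] [Module.Finite ℂ B]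
    (f : A →ₗ[ℂ] B) (g : B →ₗ[ℂ] C) (hf : Function.Injective f) (hfg : Function.Exact f g)
    (L : Submodule ℂ B) :
    Module.finrank ℂ (L.comap f) + Module.finrank ℂ (L.map g) = Module.finrank ℂ L := by
  have h1 := (g.domRestrict L).finrank_range_add_finrank_ker
  rw [LinearMap.range_domRestrict] at h1
  have h2 : Module.finrank ℂ (LinearMap.ker (g.domRestrict L)) =
      Module.finrank ℂ (L.comap f) := by
    have h3 : (LinearMap.ker (g.domRestrict L)).map L.subtype = (L.comap f).map f := by
      ext y
      constructor
      · rintro ⟨z, hz, rfl⟩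
        obtain ⟨x, hx⟩ := (hfg z.1).1 hz
        exact ⟨x, show f x ∈ L from hx ▸ z.2, hx⟩
      · rintro ⟨x, hx, rfl⟩
        exact ⟨⟨f x, hx⟩, (hfg (f x)).2 ⟨x, rfl⟩, rfl⟩
    rw [(Submodule.equivMapOfInjective L.subtype L.injective_subtype _).finrank_eq, h3,
      (Submodule.equivMapOfInjective f hf _).finrank_eq]
  omega

/-- The image of a flag in `extFlags` is a flag of type `tW`. -/
theorem isFlag_imageFamily (hS : S.ShortExact) {φ : S.X₂.FlagAmbient (tV + tW)}
    (hφ : φ ∈ extFlags S tV tW) : IsFlag S.X₃ tW (imageFamily S φ.1) where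
  subrep r i j h := by
    rintro _ ⟨_, ⟨x, hx, rfl⟩, rfl⟩
    exact ⟨S.X₂.arrow h x, hφ.1.subrep r i j h ⟨x, hx, rfl⟩, atVertex_arrow S.g h x⟩
  mono r s hrs i := Submodule.map_mono (hφ.1.mono r s hrs i)
  last r hr i := by
    have h1 : imageFamily S φ.1 (r, i) = (φ.1 (r, i)).map (atVertex S.g i) := rfl
    rw [h1, hφ.1.last r hr i, Submodule.map_top, LinearMap.range_eq_top]
    exact (shortExact_atVertex hS i).2.2
  dim r i := by
    have h1 := finrank_comap_add_finrank_map _ _ (shortExact_atVertex hS i).1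
      (shortExact_atVertex hS i).2.1 (φ.1 (r, i))
    have h2 : Module.finrank ℂ (φ.1 (r, i)) = (tV + tW) r i := hφ.1.dim r i
    have h3 : Module.finrank ℂ ((φ.1 (r, i)).comap (atVertex S.f i)) = tV r i := hφ.2.dim r i
    have h4 : tV r i + Module.finrank ℂ (imageFamily S φ.1 (r, i)) = tV r i + tW r i :=
      (congrArg (· + Module.finrank ℂ (imageFamily S φ.1 (r, i))) h3.symm).trans (h1.trans h2)
    exact Nat.add_left_cancel h4

/-- The map `φ ↦ (φ ∩ V, π(φ))`. -/
def extFlagsMap (hS : S.ShortExact) (φ : extFlags S tV tW) :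
    S.X₁.flags tV × S.X₃.flags tW :=
  (⟨⟨interFamily S φ.1.1, fun a => φ.2.2.dim a.1 a.2⟩, φ.2.2⟩,
    ⟨⟨imageFamily S φ.1.1, fun a => (isFlag_imageFamily tV tW hS φ.2).dim a.1 a.2⟩,
      isFlag_imageFamily tV tW hS φ.2⟩)

end Extension

end QuiverRep

/-! The vanishing of `Ext¹(W, V)` is used twice. It splits the sequence, so `U` may be treated as `V
⊕ W`. It also makes the differential `D`, which sends a family `F_i : W_i → V_i` to the maps `V_h
F_i - F_j W_h` for the arrows `h : i ⟶ j`, surjective (`ExtOneVanishes.differential_surjective`): a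
target of `D` twists the arrows of `V ⊕ W`, and a section of the resulting extension yields a
preimage.

Fix flags `LV` and `LW`. Every flag of `U` over this pair is a graph modulo `LV`: step `r` consists
of the vectors `w + F w + v` with `w` in `LW_r` and `v` in `LV_r`, for one family `F` that serves
all steps (`exists_twist_eq`, by a basis adapted to `LW`). Two families give the same flag exactly
when their difference respects the filtrations (`twist_eq_iff`), and stability under the arrows
means that `D F` respects them. So the fibre is `D⁻¹(arrowFil) / homFil`. As `D` is onto, its
dimension is the codimension of `homFil` minus that of `arrowFil`. In adapted bases, the codimension
of the filtered maps `W_i → V_j` counts the matrix entries that must vanish, giving the sum over `r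
< t` of the products of the steps of the flag types. The difference is the sum of Euler forms.

For local triviality, families of subspaces are described by regular sections (`SecAt`): a map to a
product of Grassmannians is a morphism at a point exactly when each component has regular sections
there (`morphAt_grassmannian`). Since all dimensions are constant, the quotients `D⁻¹(arrowFil) /
homFil` have regular frames locally on the base (`exists_quotient_frame`). A frame `k` trivializes
the bundle by `(z, c) ↦` the graph of `∑ c_j k_j`. Conversely `c` is regular in the flag because it
solves an injective linear system with regular coefficients (`regAt_coordinates`), which comes down
to Cramer's rule (`RegAt.exists_inverse`). -/

namespace SpaceWithFunctions

/-! ### Linear algebra with regular coefficients -/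

section RegAt

variable {X : Type*} (S : SpaceWithFunctions X)

theorem self_of_nhds {x : X} {P : X → Prop} (h : ∀ᶠ y in S.nhds x, P y) : P x := by
  let _ := S.toTopologicalSpace
  exact Eventually.self_of_nhds h

/-- A vector valued function is regular at `x` if all linear functionals of it are. -/
def RegAt {E : Type*} [AddCommGroup E] [Module ℂ E] (x : X) (f : X → E) : Prop :=
  ∀ l : Module.Dual ℂ E, (fun y => l (f y)) ∈ S.regularAt x

variable {S} {x : X}
variable {E F G : Type*} [AddCommGroup E] [Module ℂ E] [AddCommGroup F] [Module ℂ F]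
  [AddCommGroup G] [Module ℂ G]

theorem regAt_complex {f : X → ℂ} : S.RegAt x f ↔ f ∈ S.regularAt x := by
  constructor
  · intro h
    exact h LinearMap.id
  · intro h l
    have h1 : (fun y => l (f y)) = l 1 • f := by
      funext y
      have := l.map_smul (f y) 1
      rw [smul_eq_mul, mul_one] at this
      rw [this, Pi.smul_apply, smul_eq_mul, smul_eq_mul, mul_comm]
    rw [h1]
    exact Subalgebra.smul_mem _ h _

theorem RegAt.const (v : E) : S.RegAt x fun _ => v := fun l =>
  (S.regularAt x).algebraMap_mem (l v)

theorem RegAt.add {f g : X → E} (hf : S.RegAt x f) (hg : S.RegAt x g) :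
    S.RegAt x fun y => f y + g y := by
  intro l
  simp only [map_add]
  exact add_mem (hf l) (hg l)

theorem RegAt.sub {f g : X → E} (hf : S.RegAt x f) (hg : S.RegAt x g) :
    S.RegAt x fun y => f y - g y := by
  intro l
  simp only [map_sub]
  exact sub_mem (hf l) (hg l)

theorem RegAt.sum {ι : Type*} (s : Finset ι) {f : ι → X → E} (hf : ∀ i ∈ s, S.RegAt x (f i)) :
    S.RegAt x fun y => ∑ i ∈ s, f i y := by
  intro l
  have h1 : (fun y => l (∑ i ∈ s, f i y)) = ∑ i ∈ s, fun y => l (f i y) := by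
    funext y
    simp
  rw [h1]
  exact sum_mem fun i hi => hf i hi l

theorem RegAt.smul {a : X → ℂ} {f : X → E} (ha : S.RegAt x a) (hf : S.RegAt x f) :
    S.RegAt x fun y => a y • f y := by
  intro l
  simp only [map_smul, smul_eq_mul]
  exact mul_mem (regAt_complex.1 ha) (hf l)

theorem RegAt.map {f : X → E} (hf : S.RegAt x f) (L : E →ₗ[ℂ] F) :
    S.RegAt x fun y => L (f y) := fun l => hf (l ∘ₗ L)

theorem RegAt.congr {f g : X → E} (hf : S.RegAt x f) (h : ∀ᶠ y in S.nhds x, f y = g y) :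
    S.RegAt x g := fun l =>
  S.congr x _ _ (h.mono fun y hy => by rw [hy]) (hf l)

theorem RegAt.of_basis {ι : Type*} [Finite ι] (b : Module.Basis ι ℂ E) {f : X → E}
    (h : ∀ i, S.RegAt x fun y => b.repr (f y) i) : S.RegAt x f := by
  cases nonempty_fintype ι
  have h1 : f = fun y => ∑ i, b.repr (f y) i • b i := by
    funext y
    exact (b.sum_repr (f y)).symm
  rw [h1]
  exact RegAt.sum _ fun i _ => (h i).smul (RegAt.const _)

theorem RegAt.coord {ι : Type*} (b : Module.Basis ι ℂ E) {f : X → E}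
    (h : S.RegAt x f) (i : ι) : S.RegAt x fun y => b.repr (f y) i :=
  h.map (b.coord i)

theorem RegAt.eventually [Module.Finite ℂ E] {f : X → E} (h : S.RegAt x f) :
    ∀ᶠ y in S.nhds x, S.RegAt y f := by
  have b := Module.finBasis ℂ E
  have h1 : ∀ i, ∀ᶠ y in S.nhds x, S.RegAt y fun z => b.repr (f z) i := fun i =>
    (S.eventually_regular x _ (regAt_complex.1 (h.coord b i))).mono fun y hy =>
      regAt_complex.2 hy
  exact (eventually_all.2 h1).mono fun y hy => RegAt.of_basis b hy

theorem regAt_pi {ι : Type*} [Finite ι] {M : ι → Type*} [∀ i, AddCommGroup (M i)]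
    [∀ i, Module ℂ (M i)] {f : X → ∀ i, M i} :
    S.RegAt x f ↔ ∀ i, S.RegAt x fun y => f y i := by
  classical
  cases nonempty_fintype ι
  constructor
  · intro h i
    exact h.map (LinearMap.proj i)
  · intro h
    have h1 : f = fun y => ∑ i, LinearMap.single ℂ M i (f y i) := by
      funext y
      exact (LinearMap.sum_single_apply _ (f y)).symm
    rw [h1]
    exact RegAt.sum _ fun i _ => (h i).map _

theorem RegAt.bilin [Module.Finite ℂ E] (B : E →ₗ[ℂ] F →ₗ[ℂ] G)
    {f : X → E} {g : X → F} (hf : S.RegAt x f) (hg : S.RegAt x g) :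
    S.RegAt x fun y => B (f y) (g y) := by
  have b := Module.finBasis ℂ E
  have h1 : (fun y => B (f y) (g y)) = fun y => ∑ i, b.repr (f y) i • B (b i) (g y) := by
    funext y
    conv_lhs => rw [← b.sum_repr (f y)]
    simp only [map_sum, map_smul, LinearMap.sum_apply, LinearMap.smul_apply]
  rw [h1]
  exact RegAt.sum _ fun i _ => (hf.coord b i).smul (hg.map _)

theorem regAt_linearMap [Module.Finite ℂ E] {f : X → E →ₗ[ℂ] F} :
    S.RegAt x f ↔ ∀ v, S.RegAt x fun y => f y v := by
  constructor
  · intro h v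
    exact h.map (LinearMap.applyₗ v)
  · intro h
    have b := Module.finBasis ℂ E
    have h1 : f = fun y => ∑ i, LinearMap.smulRightₗ (b.coord i) (f y (b i)) := by
      funext y
      refine b.ext fun j => ?_
      simp [Finsupp.single_apply]
    rw [h1]
    exact RegAt.sum _ fun i _ => (h (b i)).map _

theorem RegAt.apply [Module.Finite ℂ E] [Module.Finite ℂ F] {f : X → E →ₗ[ℂ] F} {g : X → E}
    (hf : S.RegAt x f) (hg : S.RegAt x g) : S.RegAt x fun y => f y (g y) :=
  RegAt.bilin LinearMap.id hf hg

theorem RegAt.comp [Module.Finite ℂ E] [Module.Finite ℂ F] [Module.Finite ℂ G]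
    {f : X → F →ₗ[ℂ] G} {g : X → E →ₗ[ℂ] F}
    (hf : S.RegAt x f) (hg : S.RegAt x g) : S.RegAt x fun y => f y ∘ₗ g y :=
  regAt_linearMap.2 fun v => hf.apply (regAt_linearMap.1 hg v)

/-- Cramer's rule over the ring `S.regularAt x`: the matrix of `A` has entries there, its
determinant does not vanish at `x` and so has a regular inverse, and evaluation at `y` commutes with
determinant and adjugate. The inverse identities hold wherever the determinant is nonzero, hence
near `x`. -/
theorem RegAt.exists_inverse [Module.Finite ℂ E] {A : X → E →ₗ[ℂ] E} (hA : S.RegAt x A)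
    (h : Function.Injective (A x)) :
    ∃ A' : X → E →ₗ[ℂ] E, S.RegAt x A' ∧
      ∀ᶠ y in S.nhds x, A' y ∘ₗ A y = LinearMap.id ∧ A y ∘ₗ A' y = LinearMap.id := by
  classical
  have b := Module.finBasis ℂ E
  let toM := LinearMap.toMatrix b b
  let M : Matrix _ _ (S.regularAt x) := fun i j =>
    ⟨fun y => toM (A y) i j, regAt_complex.1 (by
      simpa [toM, LinearMap.toMatrix_apply] using (hA.map (LinearMap.applyₗ (b j))).coord b i)⟩
  let ev (y : X) : S.regularAt x →+* ℂ := (Pi.evalRingHom _ y).comp (S.regularAt x).val.toRingHom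
  have hM : ∀ y, (ev y).mapMatrix M = toM (A y) := fun y => rfl
  have hdet : ∀ y, (M.det : X → ℂ) y = (toM (A y)).det := fun y => by
    rw [← hM, ← RingHom.map_det]
    rfl
  have hadj : ∀ y, (ev y).mapMatrix M.adjugate = (toM (A y)).adjugate := fun y => by
    rw [← hM, ← RingHom.map_adjugate]
  have hx : (M.det : X → ℂ) x ≠ 0 := by
    rw [hdet, LinearMap.det_toMatrix]
    have : IsUnit (A x) := (Module.End.isUnit_iff _).2
      ⟨h, LinearMap.injective_iff_surjective.1 h⟩
    exact (this.map (LinearMap.det : (E →ₗ[ℂ] E) →* ℂ)).ne_zero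
  have hinv := S.inv_mem x _ M.det.2 hx
  refine ⟨fun y => toM.symm (((M.det : X → ℂ) y)⁻¹ • (ev y).mapMatrix M.adjugate), ?_, ?_⟩
  · rw [regAt_linearMap]
    intro v
    refine RegAt.of_basis b fun i => ?_
    have : ∀ y, b.repr ((toM.symm (((M.det : X → ℂ) y)⁻¹ • (ev y).mapMatrix M.adjugate)) v) i =
        ∑ j, (((M.det : X → ℂ)⁻¹ y) * (M.adjugate i j : X → ℂ) y) * b.repr v j := by
      intro y
      simp only [toM, LinearMap.toMatrix_symm, Matrix.repr_toLin, Matrix.mulVec, dotProduct]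
      rfl
    simp only [this]
    refine RegAt.sum _ fun j _ => ?_
    refine regAt_complex.2 (mul_mem (mul_mem hinv (M.adjugate i j).2)
      ((S.regularAt x).algebraMap_mem _))
  · refine (S.eventually_ne x _ M.det.2 hx).mono fun y hy => ?_
    beta_reduce
    rw [hadj, hdet]
    rw [hdet] at hy
    constructor
    · apply toM.injective
      simp only [toM, LinearMap.toMatrix_comp b b b, LinearMap.toMatrix_id,
        LinearEquiv.apply_symm_apply]
      rw [Matrix.smul_mul, Matrix.adjugate_mul, smul_smul, inv_mul_cancel₀ hy, one_smul]
    · apply toM.injective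
      simp only [toM, LinearMap.toMatrix_comp b b b, LinearMap.toMatrix_id,
        LinearEquiv.apply_symm_apply]
      rw [Matrix.mul_smul, Matrix.mul_adjugate, smul_smul, inv_mul_cancel₀ hy, one_smul]

/-- For a constant left inverse `B` of `A x`, the endomorphism `B ∘ A y` is the identity at `x`,
hence regularly invertible near `x`. -/
theorem RegAt.exists_leftInverse [Module.Finite ℂ E] [Module.Finite ℂ F] {A : X → E →ₗ[ℂ] F}
    (hA : S.RegAt x A) (h : Function.Injective (A x)) :
    ∃ A' : X → F →ₗ[ℂ] E, S.RegAt x A' ∧ ∀ᶠ y in S.nhds x, A' y ∘ₗ A y = LinearMap.id := by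
  obtain ⟨B, hB⟩ := (A x).exists_leftInverse_of_injective (LinearMap.ker_eq_bot.2 h)
  obtain ⟨C, hC, hC'⟩ := ((RegAt.const B).comp hA).exists_inverse (by
    simp only [hB]
    exact Function.injective_id)
  exact ⟨fun y => C y ∘ₗ B, hC.comp (RegAt.const B), hC'.mono fun y hy => hy.1⟩

theorem RegAt.eventually_injective [Module.Finite ℂ E] [Module.Finite ℂ F] {A : X → E →ₗ[ℂ] F}
    (hA : S.RegAt x A) (h : Function.Injective (A x)) :
    ∀ᶠ y in S.nhds x, Function.Injective (A y) := by
  obtain ⟨A', -, hA'⟩ := hA.exists_leftInverse h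
  refine hA'.mono fun y hy => ?_
  exact Function.LeftInverse.injective (g := A' y) fun v => LinearMap.congr_fun hy v

/-- The solution of a linear system that depends regularly on a parameter. -/
theorem RegAt.of_apply_eq [Module.Finite ℂ E] [Module.Finite ℂ F] {A : X → E →ₗ[ℂ] F}
    {c : X → E} {f : X → F} (hA : S.RegAt x A) (h : Function.Injective (A x))
    (hf : S.RegAt x f) (hc : ∀ᶠ y in S.nhds x, A y (c y) = f y) : S.RegAt x c := by
  obtain ⟨A', h1, h2⟩ := hA.exists_leftInverse h
  refine (h1.apply hf).congr ?_
  filter_upwards [h2, hc] with y h3 h4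
  rw [← h4]
  exact LinearMap.congr_fun h3 (c y)

end RegAt

/-! ### Morphisms at a point and universal properties of the constructions -/

section MorphAt

/-- A map is a morphism at a point if it is continuous there and pulls functions regular at the
image point back to functions regular at the point. -/
def MorphAt {X Y : Type*} (S : SpaceWithFunctions X) (T : SpaceWithFunctions Y)
    (f : X → Y) (x : X) : Prop :=
  Tendsto f (S.nhds x) (T.nhds (f x)) ∧ ∀ g ∈ T.regularAt (f x), g ∘ f ∈ S.regularAt x

variable {X Y Z : Type*} {S : SpaceWithFunctions X} {T : SpaceWithFunctions Y}
  {R : SpaceWithFunctions Z}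

theorem isMorphism_iff {f : X → Y} : S.IsMorphism T f ↔ ∀ x, S.MorphAt T f x := by
  let _ := S.toTopologicalSpace
  let _ := T.toTopologicalSpace
  constructor
  · rintro ⟨h1, h2⟩ x
    exact ⟨h1.tendsto x, h2 x⟩
  · intro h
    exact ⟨continuous_iff_continuousAt.2 fun x => (h x).1, fun x => (h x).2⟩

theorem MorphAt.comp {f : X → Y} {g : Y → Z} {x : X} (hg : T.MorphAt R g (f x))
    (hf : S.MorphAt T f x) : S.MorphAt R (g ∘ f) x :=
  ⟨hg.1.comp hf.1, fun k hk => hf.2 _ (hg.2 k hk)⟩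

theorem MorphAt.congr {f g : X → Y} {x : X} (hf : S.MorphAt T f x)
    (h : ∀ᶠ y in S.nhds x, f y = g y) : S.MorphAt T g x := by
  have hx : f x = g x := S.self_of_nhds h
  refine ⟨?_, fun k hk => ?_⟩
  · rw [← hx]
    exact hf.1.congr' h
  · rw [← hx] at hk
    exact S.congr x _ _ (h.mono fun y hy => congrArg k hy) (hf.2 k hk)

theorem RegAt.comp_morphAt {E : Type*} [AddCommGroup E] [Module ℂ E] {f : X → Y} {x : X}
    {g : Y → E} (hg : T.RegAt (f x) g) (hf : S.MorphAt T f x) : S.RegAt x (g ∘ f) :=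
  fun l => hf.2 _ (hg l)

theorem morphAt_id {x : X} : S.MorphAt S id x := ⟨tendsto_id, fun _ h => h⟩

/-- The fraction topology refines the auxiliary one only by conditions `k ≠ 0` with `k` in `A`.
These pull back to open conditions by `eventually_ne`, and fractions pull back to regular functions
by `inv_mem`. -/
theorem morphAt_ofFractions {t : TopologicalSpace Y} {A : Y → Subalgebra ℂ (Y → ℂ)}
    (hA : ∀ (x : Y) (f : Y → ℂ), f ∈ A x → ∀ᶠ y in 𝓝 x, f ∈ A y)
    {f : X → Y} {x : X} (hf : Tendsto f (S.nhds x) (𝓝 (f x)))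
    (h : ∀ a ∈ A (f x), a ∘ f ∈ S.regularAt x) : S.MorphAt (ofFractions A hA) f x := by
  have key : ∀ P : Y → Prop, NearBy A (f x) P → ∀ᶠ y in S.nhds x, P (f y) := by
    rintro P ⟨k, hk, hx, hn⟩
    filter_upwards [hf.eventually hn, S.eventually_ne x _ (h k hk) hx] with y h1 h2
    exact h1 h2
  refine ⟨?_, ?_⟩
  · intro U hU
    exact key _ ((eventually_fractionsTopology A hA (P := fun y => y ∈ U)).1 hU)
  · rintro g ⟨a, ha, b, hb, hx, hn⟩
    have h1 : a ∘ f * (b ∘ f)⁻¹ ∈ S.regularAt x :=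
      mul_mem (h a ha) (S.inv_mem x _ (h b hb) hx)
    refine S.congr x _ _ ?_ h1
    exact (key _ hn).mono fun y hy => by simp [hy, div_eq_mul_inv]

theorem ofFractions_mem {t : TopologicalSpace Y} {A : Y → Subalgebra ℂ (Y → ℂ)}
    (hA : ∀ (x : Y) (f : Y → ℂ), f ∈ A x → ∀ᶠ y in 𝓝 x, f ∈ A y) {y : Y} {f : Y → ℂ}
    (hf : f ∈ A y) : f ∈ (ofFractions A hA).regularAt y :=
  ⟨f, hf, 1, one_mem _, one_ne_zero, NearBy.of_forall A fun z => by simp⟩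

theorem ofFractions_nhds_le {t : TopologicalSpace Y} {A : Y → Subalgebra ℂ (Y → ℂ)}
    (hA : ∀ (x : Y) (f : Y → ℂ), f ∈ A x → ∀ᶠ y in 𝓝 x, f ∈ A y) {y : Y} :
    (ofFractions A hA).nhds y ≤ 𝓝 y := by
  intro U hU
  refine (eventually_fractionsTopology A hA (P := fun y => y ∈ U)).2 ?_
  exact ⟨1, one_mem _, one_ne_zero, Eventually.mono hU fun z hz _ => hz⟩

/-- Polynomial functions are generated by linear functionals, and the auxiliary topology is
indiscrete, so continuity costs nothing. -/
theorem morphAt_affine {E : Type*} [AddCommGroup E] [Module ℂ E] {f : X → E} {x : X} :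
    S.MorphAt (affine E) f x ↔ S.RegAt x f := by
  constructor
  · intro h l
    refine h.2 _ ?_
    let _ : TopologicalSpace E := ⊤
    exact ofFractions_mem _ (Algebra.subset_adjoin ⟨l, rfl⟩)
  · intro h
    let _ : TopologicalSpace E := ⊤
    refine morphAt_ofFractions _ (by rw [_root_.nhds_top]; exact tendsto_top) ?_
    intro a ha
    unfold polynomialFunctions at ha
    induction ha using Algebra.adjoin_induction with
    | mem a ha =>
      obtain ⟨l, rfl⟩ := ha
      exact h l
    | algebraMap c => exact (S.regularAt x).algebraMap_mem c
    | add a b _ _ h1 h2 => exact add_mem h1 h2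
    | mul a b _ _ h1 h2 => exact mul_mem h1 h2

theorem morphAt_fst {p : X × Y} : (S.prod T).MorphAt S Prod.fst p := by
  let _ := S.toTopologicalSpace
  let _ := T.toTopologicalSpace
  refine ⟨?_, fun g hg => ?_⟩
  · exact (continuous_fst.tendsto p).mono_left (ofFractions_nhds_le _)
  · exact ofFractions_mem _ (Algebra.subset_adjoin (Or.inl ⟨g, hg, rfl⟩))

theorem morphAt_snd {p : X × Y} : (S.prod T).MorphAt T Prod.snd p := by
  let _ := S.toTopologicalSpace
  let _ := T.toTopologicalSpace
  refine ⟨?_, fun g hg => ?_⟩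
  · exact (continuous_snd.tendsto p).mono_left (ofFractions_nhds_le _)
  · exact ofFractions_mem _ (Algebra.subset_adjoin (Or.inr ⟨g, hg, rfl⟩))

theorem MorphAt.prod {f : Z → X × Y} {z : Z} (h1 : R.MorphAt S (fun z => (f z).1) z)
    (h2 : R.MorphAt T (fun z => (f z).2) z) : R.MorphAt (S.prod T) f z := by
  let _ := S.toTopologicalSpace
  let _ := T.toTopologicalSpace
  refine morphAt_ofFractions _ ?_ ?_
  · rw [nhds_prod_eq]
    exact h1.1.prodMk h2.1
  · intro a ha
    unfold tensorAt at ha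
    induction ha using Algebra.adjoin_induction with
    | mem a ha =>
      rcases ha with ⟨a, ha, rfl⟩ | ⟨a, ha, rfl⟩
      · exact h1.2 a ha
      · exact h2.2 a ha
    | algebraMap c => exact (R.regularAt z).algebraMap_mem c
    | add a b _ _ h1 h2 => exact add_mem h1 h2
    | mul a b _ _ h1 h2 => exact mul_mem h1 h2

theorem morphAt_val {A : Set X} {x : A} : (S.restrict A).MorphAt S Subtype.val x := by
  let _ := S.toTopologicalSpace
  exact ⟨continuous_subtype_val.tendsto x, fun g hg => ⟨g, hg, Eventually.of_forall fun _ => rfl⟩⟩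

theorem MorphAt.restrict {A : Set Y} {f : X → A} {x : X}
    (h : S.MorphAt T (fun z => (f z : Y)) x) : S.MorphAt (T.restrict A) f x := by
  let _ := T.toTopologicalSpace
  have h1 : Tendsto f (S.nhds x) (𝓝 (f x)) := tendsto_subtype_rng.2 h.1
  refine ⟨h1, ?_⟩
  rintro g ⟨k, hk, hn⟩
  exact S.congr x _ _ ((h1.eventually hn).mono fun y hy => hy.symm) (h.2 k hk)

theorem morphAt_quotient {q : X → Y} {x : X} : S.MorphAt (S.quotient q) q x := by
  let _ := S.toTopologicalSpace
  let _ := TopologicalSpace.coinduced q S.toTopologicalSpace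
  exact ⟨continuous_coinduced_rng.tendsto x, fun g hg => Eventually.self_of_nhds hg x rfl⟩

end MorphAt

end SpaceWithFunctions

namespace SpaceWithFunctions

/-! ### Families of subspaces with regular sections -/

section SecAt

variable {X : Type*} (S : SpaceWithFunctions X) {x : X}
variable {E F : Type*} [AddCommGroup E] [Module ℂ E] [AddCommGroup F] [Module ℂ F]

/-- A family of subspaces has, near `x`, regular sections through all vectors of the member
at `x`. -/
def SecAt (x : X) (ψ : X → Submodule ℂ E) : Prop :=
  ∀ v ∈ ψ x, ∃ σ : X → E, S.RegAt x σ ∧ σ x = v ∧ ∀ᶠ y in S.nhds x, σ y ∈ ψ y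

variable {S}

theorem SecAt.comp_morphAt {Y : Type*} {T : SpaceWithFunctions Y} {f : X → Y}
    {ψ : Y → Submodule ℂ E} (h : T.SecAt (f x) ψ) (hf : S.MorphAt T f x) :
    S.SecAt x (fun y => ψ (f y)) := by
  intro v hv
  obtain ⟨σ, h1, h2, h3⟩ := h v hv
  exact ⟨σ ∘ f, h1.comp_morphAt hf, h2, hf.1.eventually h3⟩

theorem SecAt.map {ψ : X → Submodule ℂ E} (h : S.SecAt x ψ) (g : E →ₗ[ℂ] F) :
    S.SecAt x (fun y => (ψ y).map g) := by
  rintro _ ⟨v, hv, rfl⟩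
  obtain ⟨σ, h1, h2, h3⟩ := h v hv
  exact ⟨fun y => g (σ y), h1.map g, congrArg g h2, h3.mono fun y hy => ⟨_, hy, rfl⟩⟩

theorem RegAt.linearCombination {ι : Type*} [Fintype ι] [Module.Finite ℂ E] {σ : ι → X → E}
    (h : ∀ i, S.RegAt x (σ i)) :
    S.RegAt x fun y => Fintype.linearCombination ℂ (fun i => σ i y) := by
  rw [regAt_linearMap]
  intro c
  simp only [Fintype.linearCombination_apply]
  exact RegAt.sum _ fun i _ => (RegAt.const (c i)).smul (h i)

theorem span_range_eq_of_finrank_eq {ι : Type*} [Fintype ι] {b : ι → E} {L : Submodule ℂ E}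
    [Module.Finite ℂ E]
    (hb : LinearIndependent ℂ b) (hL : ∀ i, b i ∈ L) (hc : Module.finrank ℂ L = Fintype.card ι) :
    Submodule.span ℂ (Set.range b) = L := by
  apply Submodule.eq_of_le_of_finrank_eq
  · rw [Submodule.span_le]
    rintro _ ⟨i, rfl⟩
    exact hL i
  · rw [finrank_span_eq_card hb, hc]

/-- Regular frames of a family of subspaces of constant dimension. -/
theorem SecAt.exists_frame [Module.Finite ℂ E] {ψ : X → Submodule ℂ E} (h : S.SecAt x ψ)
    {k : ℕ} (hk : ∀ y, Module.finrank ℂ (ψ y) = k) :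
    ∃ β : X → Fin k → E, (∀ i, S.RegAt x fun y => β y i) ∧ (∀ i, β x i ∈ ψ x) ∧
      ∀ᶠ y in S.nhds x, LinearIndependent ℂ (β y) ∧
        Submodule.span ℂ (Set.range (β y)) = ψ y := by
  let b := Module.finBasisOfFinrankEq ℂ (ψ x) (hk x)
  choose σ h1 h2 h3 using fun i => h (b i) (b i).2
  -- Sections through a basis of `ψ x` stay independent near `x`, and then span `ψ y` because the
  -- dimension is constant.
  have hx : Function.Injective (Fintype.linearCombination ℂ (fun i => σ i x)) := by
    rw [← linearIndependent_iff_injective_fintypeLinearCombination]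
    simp only [h2]
    exact b.linearIndependent.map' (ψ x).subtype (Submodule.ker_subtype _)
  refine ⟨fun y i => σ i y, h1, fun i => by simp [h2], ?_⟩
  filter_upwards [(RegAt.linearCombination h1).eventually_injective hx, eventually_all.2 h3]
    with y hy hy'
  rw [← linearIndependent_iff_injective_fintypeLinearCombination] at hy
  exact ⟨hy, span_range_eq_of_finrank_eq hy hy' (by rw [hk, Fintype.card_fin])⟩

/-- Constancy of the rank of `g` on `ψ y` is the point: near `x`, the image of `ψ y` has a frame `g
(τ i y)`, so the error `g (σ y)` of a section `σ` can be removed by a regular combination of the `τ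
i`. -/
theorem SecAt.ker [Module.Finite ℂ E] [Module.Finite ℂ F] {ψ : X → Submodule ℂ E}
    (h : S.SecAt x ψ) (g : E →ₗ[ℂ] F) {k : ℕ} (hk : ∀ y, Module.finrank ℂ ((ψ y).map g) = k) :
    S.SecAt x (fun y => ψ y ⊓ LinearMap.ker g) := by
  rintro v ⟨hv, hv'⟩
  obtain ⟨σ, h1, h2, h3⟩ := h v hv
  let b := Module.finBasisOfFinrankEq ℂ ((ψ x).map g) (hk x)
  choose w hw hw' using fun i => (b i).2
  choose τ t1 t2 t3 using fun i => h (w i) (hw i)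
  have hx : LinearIndependent ℂ (fun i => g (τ i x)) := by
    simp only [t2, hw']
    exact b.linearIndependent.map' (Submodule.subtype _) (Submodule.ker_subtype _)
  rw [linearIndependent_iff_injective_fintypeLinearCombination] at hx
  have hA := RegAt.linearCombination fun i => (t1 i).map g
  have hex : ∀ᶠ y in S.nhds x, ∃ c : Fin k → ℂ,
      Fintype.linearCombination ℂ (fun i => g (τ i y)) c = g (σ y) := by
    filter_upwards [hA.eventually_injective hx, eventually_all.2 t3, h3] with y i1 i2 i3
    rw [← linearIndependent_iff_injective_fintypeLinearCombination] at i1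
    have h5 := span_range_eq_of_finrank_eq i1 (fun i => Submodule.mem_map_of_mem (f := g) (i2 i))
      (by rw [hk, Fintype.card_fin])
    rw [← Fintype.range_linearCombination ℂ] at h5
    have h6 : g (σ y) ∈ (ψ y).map g := Submodule.mem_map_of_mem i3
    rwa [← h5] at h6
  -- An arbitrary choice is harmless: near `x` the solution exists and is unique, which forces
  -- regularity; elsewhere the value is irrelevant.
  let c : X → Fin k → ℂ := fun y => Classical.epsilon fun c =>
    Fintype.linearCombination ℂ (fun i => g (τ i y)) c = g (σ y)
  have hc : ∀ᶠ y in S.nhds x,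
      Fintype.linearCombination ℂ (fun i => g (τ i y)) (c y) = g (σ y) :=
    hex.mono fun y hy => Classical.epsilon_spec hy
  have hcr : S.RegAt x c := hA.of_apply_eq hx (h1.map g) hc
  -- The correction vanishes at `x` since `v` already lies in the kernel, so the section still
  -- passes through `v`.
  have hcx : c x = 0 := by
    apply hx
    rw [S.self_of_nhds hc, h2, map_zero]
    exact hv'
  refine ⟨fun y => σ y - Fintype.linearCombination ℂ (fun i => τ i y) (c y),
    h1.sub ((RegAt.linearCombination t1).apply hcr), ?_, ?_⟩
  · simp [hcx, h2]
  · filter_upwards [hc, eventually_all.2 t3, h3] with y i1 i2 i3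
    refine ⟨sub_mem i3 ?_, ?_⟩
    · rw [Fintype.linearCombination_apply]
      exact sum_mem fun i _ => Submodule.smul_mem _ _ (i2 i)
    · refine LinearMap.mem_ker.2 ?_
      simp only [map_sub, ← i1, Fintype.linearCombination_apply, map_sum, map_smul, sub_self]

/-- By exactness, `f` identifies the preimage with `ψ y ⊓ ker g`; a linear retraction `ρ` of `f`
brings sections of the latter back. -/
theorem SecAt.comap {G : Type*} [AddCommGroup G] [Module ℂ G] [Module.Finite ℂ E]
    [Module.Finite ℂ F] {ψ : X → Submodule ℂ E} (h : S.SecAt x ψ)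
    {f : G →ₗ[ℂ] E} {g : E →ₗ[ℂ] F} (hf : Function.Injective f) (hfg : Function.Exact f g) {k : ℕ}
    (hk : ∀ y, Module.finrank ℂ ((ψ y).map g) = k) :
    S.SecAt x (fun y => (ψ y).comap f) := by
  intro v hv
  obtain ⟨σ, h1, h2, h3⟩ := h.ker g hk (f v) ⟨hv, (hfg _).2 ⟨v, rfl⟩⟩
  obtain ⟨ρ, hρ⟩ := f.exists_leftInverse_of_injective (LinearMap.ker_eq_bot.2 hf)
  have hρ' : ∀ z, ρ (f z) = z := fun z => LinearMap.congr_fun hρ z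
  refine ⟨fun y => ρ (σ y), h1.map ρ, by simp [h2, hρ'], h3.mono ?_⟩
  rintro y ⟨i1, i2⟩
  obtain ⟨z, hz⟩ := (hfg _).1 i2
  rw [← hz] at i1
  show f (ρ (σ y)) ∈ ψ y
  rwa [← hz, hρ']

end SecAt

/-! ### Morphisms to products of Grassmannians -/

section Grassmannian

variable {κ : Type*} {M : κ → Type*} [∀ a, AddCommGroup (M a)] [∀ a, Module ℂ (M a)] {k : κ → ℕ}

theorem range_linearCombination_frame (b : frames M k) (a : κ) :
    LinearMap.range (Fintype.linearCombination ℂ (b.1 a)) = (spanFrames M k b).1 a :=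
  Fintype.range_linearCombination ℂ _

theorem regAt_frames [Finite κ] (b : frames M k) (a : κ) (i : Fin (k a)) :
    ((affine (∀ a, Fin (k a) → M a)).restrict (frames M k)).RegAt b fun b' => b'.1 a i := by
  have h1 := morphAt_affine.1 (morphAt_id (S := affine (∀ a, Fin (k a) → M a)) (x := b.1))
  exact RegAt.comp_morphAt (regAt_pi.1 (regAt_pi.1 h1 a) i) morphAt_val

variable [Finite κ] [∀ a, Module.Finite ℂ (M a)]

/-- The tautological families of subspaces on a product of Grassmannians have regular sections. -/
theorem secAt_grassmannian (L₀ : MultiGrassmannian M k) (a : κ) :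
    (MultiGrassmannian.space M k).SecAt L₀ (fun L => L.1 a) := by
  intro v hv
  obtain ⟨P, hP⟩ := (L₀.1 a).subtype.exists_leftInverse_of_injective (Submodule.ker_subtype _)
  have hP' : ∀ z : L₀.1 a, P z = z := fun z => LinearMap.congr_fun hP z
  let SF := (affine (∀ a, Fin (k a) → M a)).restrict (frames M k)
  let tF := SF.toTopologicalSpace
  -- The standard chart around `L₀`: for a linear retraction `P` onto `L₀`, the subspaces that `P`
  -- maps isomorphically onto `L₀`. The section takes the unique vector of `L` above `v`.
  let U : Set (MultiGrassmannian M k) := {L | Function.Injective (P ∘ₗ (L.1 a).subtype)}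
  let A : frames M k → (Fin (k a) → ℂ) →ₗ[ℂ] L₀.1 a := fun b =>
    P ∘ₗ Fintype.linearCombination ℂ (b.1 a)
  have hAU : ∀ b : frames M k, Function.Injective (A b) ↔ spanFrames M k b ∈ U := by
    intro b
    have h1 : Function.Injective (Fintype.linearCombination ℂ (b.1 a)) :=
      linearIndependent_iff_injective_fintypeLinearCombination.1 (b.2 a)
    constructor
    · rintro h ⟨z, hz⟩ ⟨z', hz'⟩ hzz
      rw [← range_linearCombination_frame] at hz hz'
      obtain ⟨c, rfl⟩ := hz
      obtain ⟨c', rfl⟩ := hz'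
      have : c = c' := h hzz
      subst this
      rfl
    · intro h c c' hcc
      apply h1
      have hm : ∀ c, Fintype.linearCombination ℂ (b.1 a) c ∈ (spanFrames M k b).1 a := fun c => by
        rw [← range_linearCombination_frame]
        exact ⟨c, rfl⟩
      exact congrArg Subtype.val (@h ⟨_, hm c⟩ ⟨_, hm c'⟩ hcc)
  have hAreg : ∀ b, SF.RegAt b A := fun b =>
    (RegAt.const P).comp (RegAt.linearCombination fun i => regAt_frames b a i)
  -- In the quotient structure, openness and regularity are both tested on frames, where `U` becomes
  -- the injectivity of `A b`.
  have hU : (MultiGrassmannian.space M k).IsOpenSet U := by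
    refine isOpen_coinduced.2 (isOpen_iff_mem_nhds.2 fun b hb => ?_)
    have h1 := (hAreg b).eventually_injective ((hAU b).2 hb)
    exact h1.mono fun b' hb' => (hAU b').1 hb'
  have hx : L₀ ∈ U := by
    intro z z' h
    have h1 : P z = P z' := h
    rwa [hP', hP'] at h1
  have hex : ∀ L : MultiGrassmannian M k, L ∈ U → ∃ z : L.1 a, P z = ⟨v, hv⟩ := by
    intro L hL
    have h1 := (LinearMap.injective_iff_surjective_of_finrank_eq_finrank
      (f := P ∘ₗ (L.1 a).subtype) (by rw [L.2, L₀.2])).1 hL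
    exact h1 _
  -- Outside the chart `σ L` is an arbitrary vector, but still one of `L`.
  choose! σ hσ using hex
  refine ⟨fun L => σ L, ?_, ?_, ?_⟩
  · intro l
    let _ := (MultiGrassmannian.space M k).toTopologicalSpace
    have hUn : ∀ᶠ L in 𝓝 L₀, L ∈ U := IsOpen.mem_nhds hU hx
    refine Eventually.mono hUn ?_
    rintro L hL b rfl
    have hb := (hAU b).2 hL
    have hev : ∀ᶠ b' in SF.nhds b, spanFrames M k b' ∈ U :=
      ((hAreg b).eventually_injective hb).mono fun b' hb' => (hAU b').1 hb'
    -- On frames, the coordinates `c` of the section solve `A b' (c b') = v` near `b`, hence are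
    -- regular.
    choose c hc using fun b' : frames M k => show (σ (spanFrames M k b') : M a) ∈
      LinearMap.range (Fintype.linearCombination ℂ (b'.1 a)) from by
        rw [range_linearCombination_frame]
        exact (σ (spanFrames M k b')).2
    have hcr : SF.RegAt b c := (hAreg b).of_apply_eq hb
      (f := fun _ => ⟨v, hv⟩) (RegAt.const _) (hev.mono fun b' hb' => by
        show P (Fintype.linearCombination ℂ (b'.1 a) (c b')) = _
        rw [hc]
        exact hσ _ hb')
    have h2 : SF.RegAt b fun b' => (σ (spanFrames M k b') : M a) := by
      simp only [← hc]
      exact (RegAt.linearCombination fun i => regAt_frames b a i).apply hcr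
    exact h2 l
  · have h1 : P (σ L₀ : M a) = P v := by
      rw [hσ L₀ hx]
      exact (hP' ⟨v, hv⟩).symm
    have h2 : P (σ L₀ : M a) = P (⟨v, hv⟩ : L₀.1 a) := h1
    rw [hP', hP'] at h2
    exact congrArg Subtype.val h2
  · exact Eventually.of_forall fun L => (σ L).2

/-- A map to a product of Grassmannians is a morphism at a point as soon as its components have
regular sections. -/
theorem morphAt_grassmannian {X : Type*} {S : SpaceWithFunctions X} {x : X}
    {f : X → MultiGrassmannian M k} :
    S.MorphAt (MultiGrassmannian.space M k) f x ↔ ∀ a, S.SecAt x (fun y => (f y).1 a) := by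
  classical
  constructor
  · intro h a
    exact (secAt_grassmannian (f x) a).comp_morphAt h
  intro h
  choose β h1 _ h2 using fun a => (h a).exists_frame fun y => (f y).2 a
  have h3 : ∀ᶠ y in S.nhds x, ∀ a, LinearIndependent ℂ (β a y) ∧
      Submodule.span ℂ (Set.range (β a y)) = (f y).1 a := eventually_all.2 h2
  -- A lift to frames defined everywhere: where the local frames fail to be independent, the frame
  -- at `x` serves as a default.
  let β' : X → frames M k := fun y =>
    if hy : (fun a => β a y) ∈ frames M k then ⟨_, hy⟩
    else ⟨fun a => β a x, fun a => (S.self_of_nhds h3 a).1⟩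
  have h4 : ∀ᶠ y in S.nhds x, (fun a => β a y) = (β' y).1 := h3.mono fun y hy => by
    have : (fun a => β a y) ∈ frames M k := fun a => (hy a).1
    simp only [β', dif_pos this]
  have h5 : S.MorphAt ((affine (∀ a, Fin (k a) → M a)).restrict (frames M k)) β' x := by
    refine MorphAt.restrict (morphAt_affine.2 ?_)
    refine RegAt.congr ?_ h4
    exact regAt_pi.2 fun a => regAt_pi.2 fun i => h1 a i
  refine MorphAt.congr (morphAt_quotient.comp h5) ?_
  filter_upwards [h3, h4] with y i3 i4
  refine Subtype.ext (funext fun a => ?_)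
  rw [← (i3 a).2]
  show Submodule.span ℂ (Set.range ((β' y).1 a)) = _
  rw [← i4]

end Grassmannian

end SpaceWithFunctions

/-! ### Adapted bases and filtered maps -/

section Filtrations

variable {V W : Type*} [AddCommGroup V] [Module ℂ V] [AddCommGroup W] [Module ℂ W] {d : ℕ}

/-- The basis `b` is adapted to the filtration `L`, with `lev i` the step at which `b i` enters. -/
def IsAdapted {ι : Type*} (L : Fin d → Submodule ℂ V) (b : Module.Basis ι ℂ V)
    (lev : ι → Fin d) : Prop :=
  ∀ r, L r = Submodule.span ℂ (b '' {i | lev i ≤ r})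

/-- A basis of each step is extended to a basis of the next one. -/
theorem exists_adapted_sequence (L : ℕ → Submodule ℂ V) (hL : Monotone L) :
    ∃ s : ℕ → Set V, Monotone s ∧ ∀ n, LinearIndepOn ℂ id (s n) ∧ Submodule.span ℂ (s n) = L n := by
  have h0 : ∃ s : Set V, LinearIndepOn ℂ id s ∧ Submodule.span ℂ s = L 0 := by
    obtain ⟨b, h1, -, h3, h4⟩ := exists_linearIndepOn_id_extension
      (linearIndepOn_empty ℂ (id : V → V)) (Set.empty_subset (L 0 : Set V))
    exact ⟨b, h4, le_antisymm (Submodule.span_le.2 h1) h3⟩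
  have hs : ∀ (n : ℕ) (s : {s : Set V // LinearIndepOn ℂ id s ∧ Submodule.span ℂ s = L n}),
      ∃ t : {s : Set V // LinearIndepOn ℂ id s ∧ Submodule.span ℂ s = L (n + 1)}, s.1 ⊆ t.1 := by
    rintro n ⟨s, hs, hs'⟩
    have h1 : s ⊆ (L (n + 1) : Set V) := by
      rw [← Submodule.span_le, hs']
      exact hL n.le_succ
    obtain ⟨b, h1, h2, h3, h4⟩ := exists_linearIndepOn_id_extension hs h1
    exact ⟨⟨b, h4, le_antisymm (Submodule.span_le.2 h1) h3⟩, h2⟩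
  choose next hnext using hs
  let seq : ∀ n, {s : Set V // LinearIndepOn ℂ id s ∧ Submodule.span ℂ s = L n} := fun n =>
    Nat.rec ⟨h0.choose, h0.choose_spec⟩ next n
  exact ⟨fun n => (seq n).1, monotone_nat_of_le_succ fun n => hnext n (seq n), fun n => (seq n).2⟩

theorem exists_isAdapted [Module.Finite ℂ V] (L : Fin d → Submodule ℂ V) (hL : Monotone L)
    (hd : 0 < d) (htop : ∀ r : Fin d, r.val + 1 = d → L r = ⊤) :
    ∃ (b : Module.Basis (Fin (Module.finrank ℂ V)) ℂ V) (lev : Fin (Module.finrank ℂ V) → Fin d),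
      IsAdapted L b lev := by
  classical
  -- The filtration is continued to all of `ℕ` by repeating its last step, of index `d - 1`, which
  -- is the whole space.
  obtain ⟨s, hs, h⟩ := exists_adapted_sequence
    (fun n => L ⟨min n (d - 1), by omega⟩) (fun m n hmn => hL (by
      simp only [Fin.mk_le_mk]
      omega))
  have hr : ∀ r : Fin d, Submodule.span ℂ (s r) = L r := by
    intro r
    rw [(h r).2]
    congr 1
    ext
    simp only
    omega
  let T := s (d - 1)
  have hT : ⊤ ≤ Submodule.span ℂ (Set.range ((↑) : T → V)) := by
    rw [Subtype.range_coe, (h (d - 1)).2, htop]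
    simp only [min_self]
    omega
  have hli : LinearIndependent ℂ ((↑) : T → V) := (h (d - 1)).1
  let b₀ : Module.Basis T ℂ V := Module.Basis.mk hli hT
  have hb₀ : ∀ x : T, b₀ x = x := Module.Basis.mk_apply hli hT
  have : Finite T := Module.Finite.finite_basis b₀
  cases nonempty_fintype T
  let e : T ≃ Fin (Module.finrank ℂ V) :=
    Fintype.equivFinOfCardEq (Module.finrank_eq_card_basis b₀).symm
  have hex : ∀ x : T, ∃ n, (x : V) ∈ s n := fun x => ⟨d - 1, x.2⟩
  -- The level of a basis vector is the first step whose basis contains it.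
  let lev₀ : T → Fin d := fun x => ⟨Nat.find (hex x), by
    have := Nat.find_min' (hex x) x.2
    omega⟩
  have hlev : ∀ (x : T) (r : Fin d), lev₀ x ≤ r ↔ (x : V) ∈ s r := by
    intro x r
    constructor
    · intro h1
      exact hs h1 (Nat.find_spec (hex x))
    · intro h1
      exact Nat.find_min' (hex x) h1
  refine ⟨b₀.reindex e, lev₀ ∘ e.symm, fun r => ?_⟩
  rw [← hr r]
  congr 1
  ext x
  constructor
  · intro hx
    have hxT : x ∈ T := hs (by omega) hx
    refine ⟨e ⟨x, hxT⟩, ?_, by simp [hb₀]⟩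
    simp only [Set.mem_ofPred_eq, Function.comp, Equiv.symm_apply_apply]
    exact (hlev _ _).2 hx
  · rintro ⟨i, hi, rfl⟩
    rw [Module.Basis.reindex_apply, hb₀]
    exact (hlev _ _).1 hi

theorem IsAdapted.mem_iff {ι : Type*} {L : Fin d → Submodule ℂ V} {b : Module.Basis ι ℂ V}
    {lev : ι → Fin d} (h : IsAdapted L b lev) {r : Fin d} {v : V} :
    v ∈ L r ↔ ∀ i, r < lev i → b.repr v i = 0 := by
  rw [h r, Module.Basis.mem_span_image]
  constructor
  · intro h1 i hi
    by_contra h2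
    have h3 : lev i ≤ r := h1 (Finsupp.mem_support_iff.2 h2)
    exact absurd hi (not_lt.2 h3)
  · intro h1 i hi
    by_contra h2
    exact Finsupp.mem_support_iff.1 hi (h1 i (not_le.1 h2))

theorem IsAdapted.basis_mem {ι : Type*} {L : Fin d → Submodule ℂ V} {b : Module.Basis ι ℂ V}
    {lev : ι → Fin d} (h : IsAdapted L b lev) (i : ι) : b i ∈ L (lev i) := by
  rw [h]
  exact Submodule.subset_span ⟨i, le_refl (lev i), rfl⟩

theorem IsAdapted.le_of_forall {ι : Type*} {L : Fin d → Submodule ℂ V} {b : Module.Basis ι ℂ V}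
    {lev : ι → Fin d} (h : IsAdapted L b lev) {r : Fin d} {K : Submodule ℂ V}
    (hK : ∀ i, lev i ≤ r → b i ∈ K) : L r ≤ K := by
  rw [h, Submodule.span_le]
  rintro _ ⟨i, hi, rfl⟩
  exact hK i hi

theorem IsAdapted.card_le {n : ℕ} {L : Fin d → Submodule ℂ V} {b : Module.Basis (Fin n) ℂ V}
    {lev : Fin n → Fin d} (h : IsAdapted L b lev) (r : Fin d) :
    Module.finrank ℂ (L r) = (Finset.univ.filter fun i => lev i ≤ r).card := by
  have h1 : LinearIndependent ℂ (fun i : {i // lev i ≤ r} => b i) :=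
    b.linearIndependent.comp _ Subtype.val_injective
  rw [h r, ← Fintype.card_subtype, ← finrank_span_eq_card h1, Set.image_eq_range]
  rfl

/-- The linear maps that respect two filtrations. -/
def filteredMaps (LW : Fin d → Submodule ℂ W) (LV : Fin d → Submodule ℂ V) :
    Submodule ℂ (W →ₗ[ℂ] V) where
  carrier := {F | ∀ r, ∀ w ∈ LW r, F w ∈ LV r}
  zero_mem' := fun r _ _ => zero_mem (LV r)
  add_mem' := fun h h' r w hw => add_mem (h r w hw) (h' r w hw)
  smul_mem' := fun c _ h r w hw => Submodule.smul_mem _ c (h r w hw)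

/-- In adapted bases the filtered maps are the block triangular matrices: no entry may lead from a
level to a strictly later one. -/
theorem mem_filteredMaps_iff_repr {ι κ : Type*} {LW : Fin d → Submodule ℂ W}
    {LV : Fin d → Submodule ℂ V} {bW : Module.Basis ι ℂ W} {bV : Module.Basis κ ℂ V}
    {levW : ι → Fin d} {levV : κ → Fin d} (hW : IsAdapted LW bW levW) (hV : IsAdapted LV bV levV)
    {F : W →ₗ[ℂ] V} :
    F ∈ filteredMaps LW LV ↔ ∀ i j, levW i < levV j → bV.repr (F (bW i)) j = 0 := by
  constructor
  · intro h i j hij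
    exact hV.mem_iff.1 (h (levW i) (bW i) (hW.basis_mem i)) j hij
  · intro h r
    have h1 : LW r ≤ (LV r).comap F := hW.le_of_forall fun i hi =>
      hV.mem_iff.2 fun j hj => h i j (hi.trans_lt hj)
    exact h1

/-- The filtered maps are the kernel of the surjection that reads off the forbidden matrix entries,
those at pairs of indices with `levW i < levV j`; grouping these pairs by levels gives the double
sum. -/
theorem finrank_quotient_filteredMaps {m n : ℕ} {LW : Fin d → Submodule ℂ W}
    {LV : Fin d → Submodule ℂ V} {bW : Module.Basis (Fin m) ℂ W} {bV : Module.Basis (Fin n) ℂ V}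
    {levW : Fin m → Fin d} {levV : Fin n → Fin d} (hW : IsAdapted LW bW levW)
    (hV : IsAdapted LV bV levV) :
    Module.finrank ℂ ((W →ₗ[ℂ] V) ⧸ filteredMaps LW LV) =
      ∑ r, ∑ t ∈ Finset.Ioi r, (Finset.univ.filter fun i => levW i = r).card *
        (Finset.univ.filter fun j => levV j = t).card := by
  classical
  let J := {p : Fin m × Fin n // levW p.1 < levV p.2}
  let Θ : (W →ₗ[ℂ] V) →ₗ[ℂ] (J → ℂ) :=
    LinearMap.pi fun p => bV.coord p.1.2 ∘ₗ LinearMap.applyₗ (bW p.1.1)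
  have hker : LinearMap.ker Θ = filteredMaps LW LV := by
    ext F
    rw [mem_filteredMaps_iff_repr hW hV, LinearMap.mem_ker]
    constructor
    · intro h i j hij
      exact congrFun h ⟨(i, j), hij⟩
    · intro h
      funext p
      exact h p.1.1 p.1.2 p.2
  have hsurj : Function.Surjective Θ := by
    intro c
    refine ⟨bW.constr ℂ fun i => ∑ j, (if h : levW i < levV j then c ⟨(i, j), h⟩ else 0) • bV j, ?_⟩
    funext p
    simp only [Θ, LinearMap.pi_apply, LinearMap.comp_apply, LinearMap.applyₗ_apply_apply,
      Module.Basis.constr_basis, Module.Basis.coord_apply, Module.Basis.repr_sum_self]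
    rw [dif_pos p.2]
  rw [← hker, (Θ.quotKerEquivOfSurjective hsurj).finrank_eq, Module.finrank_fintype_fun_eq_card,
    Fintype.card_subtype]
  simp only [Finset.card_filter, Finset.sum_mul_sum, Fintype.sum_prod_type]
  have h1 : ∀ r : Fin d, ∑ t ∈ Finset.Ioi r, ∑ i, ∑ j,
      ((if levW i = r then 1 else 0) * (if levV j = t then 1 else 0) : ℕ) =
      ∑ i, ∑ j, if levW i = r then (if r < levV j then 1 else 0) else 0 := by
    intro r
    rw [Finset.sum_comm]
    refine Finset.sum_congr rfl fun i _ => ?_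
    rw [Finset.sum_comm]
    refine Finset.sum_congr rfl fun j _ => ?_
    by_cases h : levW i = r
    · simp [h]
    · simp [h]
  simp only [h1]
  symm
  rw [Finset.sum_comm]
  refine Finset.sum_congr rfl fun i _ => ?_
  rw [Finset.sum_comm]
  refine Finset.sum_congr rfl fun j _ => ?_
  simp

end Filtrations

/-! ### Regular families of filtrations and of quotients -/

namespace SpaceWithFunctions

variable {X : Type*} {S : SpaceWithFunctions X} {x : X}
variable {V W : Type*} [AddCommGroup V] [Module ℂ V] [AddCommGroup W] [Module ℂ W] {d : ℕ}
  [Module.Finite ℂ V] [Module.Finite ℂ W]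

/-- A family of filtrations with regular sections is locally moved by regular automorphisms. -/
theorem exists_transport (L : X → Fin d → Submodule ℂ V) (hmono : ∀ y, Monotone (L y))
    (hd : 0 < d) (htop : ∀ y, ∀ r : Fin d, r.val + 1 = d → L y r = ⊤)
    (hdim : ∀ y r, Module.finrank ℂ (L y r) = Module.finrank ℂ (L x r))
    (hsec : ∀ r, S.SecAt x fun y => L y r) :
    ∃ g g' : X → V →ₗ[ℂ] V, S.RegAt x g ∧ S.RegAt x g' ∧ g x = LinearMap.id ∧
      g' x = LinearMap.id ∧ ∀ᶠ y in S.nhds x, ∀ r,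
        (∀ v ∈ L x r, g y v ∈ L y r) ∧ ∀ v, v ∈ L y r ↔ g' y v ∈ L x r := by
  -- Each vector of a basis adapted to `L x` is extended to a regular section of the step at which
  -- it enters; `g y` sends the basis to the values of these sections. So `g y` maps `L x r` into `L
  -- y r`, and onto it by equality of dimensions.
  obtain ⟨b, lev, hb⟩ := exists_isAdapted (L x) (hmono x) hd (htop x)
  choose σ h1 h2 h3 using fun i => hsec (lev i) (b i) (hb.basis_mem i)
  let g : X → V →ₗ[ℂ] V := fun y => b.constr ℂ fun i => σ i y
  have hg : S.RegAt x g := by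
    have : S.RegAt x (fun y i => σ i y : X → _ → V) := regAt_pi.2 h1
    exact this.map (b.constr ℂ).toLinearMap
  have hgx : g x = LinearMap.id := b.ext fun i => by simp [g, h2]
  obtain ⟨g', hg', hgg⟩ := hg.exists_inverse (by rw [hgx]; exact Function.injective_id)
  refine ⟨g, g', hg, hg', hgx, ?_, ?_⟩
  · have := (S.self_of_nhds hgg).1
    rwa [hgx, LinearMap.comp_id] at this
  filter_upwards [hgg, eventually_all.2 h3] with y hy hy' r
  have h4 : L x r ≤ (L y r).comap (g y) := hb.le_of_forall fun i hi => by
    show g y (b i) ∈ L y r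
    simp only [g, Module.Basis.constr_basis]
    exact hmono y hi (hy' i)
  have hinj : Function.Injective (g y) :=
    Function.LeftInverse.injective (g := g' y) fun v => LinearMap.congr_fun hy.1 v
  have h5 : (L x r).map (g y) = L y r := by
    apply Submodule.eq_of_le_of_finrank_eq (Submodule.map_le_iff_le_comap.2 h4)
    rw [hdim, ← (Submodule.equivMapOfInjective (g y) hinj (L x r)).finrank_eq]
  refine ⟨h4, fun v => ?_⟩
  constructor
  · intro hv
    rw [← h5] at hv
    obtain ⟨z, hz, rfl⟩ := hv
    have := LinearMap.congr_fun hy.1 z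
    simp only [LinearMap.comp_apply, LinearMap.id_apply] at this
    rwa [this]
  · intro hv
    have := LinearMap.congr_fun hy.2 v
    simp only [LinearMap.comp_apply, LinearMap.id_apply] at this
    rw [← this]
    exact h4 hv

/-- A filtered map `F` at `x` extends to `g y ∘ F ∘ h y`: `h` moves the source filtration back to
`x`, and `g` moves the target filtration from `x` to `y`. -/
theorem secAt_filteredMaps {LW : X → Fin d → Submodule ℂ W} {LV : X → Fin d → Submodule ℂ V}
    {g : X → V →ₗ[ℂ] V} {h : X → W →ₗ[ℂ] W} (hg : S.RegAt x g) (hh : S.RegAt x h)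
    (hgx : g x = LinearMap.id) (hhx : h x = LinearMap.id)
    (hV : ∀ᶠ y in S.nhds x, ∀ r, ∀ v ∈ LV x r, g y v ∈ LV y r)
    (hW : ∀ᶠ y in S.nhds x, ∀ r, ∀ v ∈ LW y r, h y v ∈ LW x r) :
    S.SecAt x fun y => filteredMaps (LW y) (LV y) := by
  intro F hF
  refine ⟨fun y => g y ∘ₗ F ∘ₗ h y, hg.comp ((RegAt.const F).comp hh), ?_, ?_⟩
  · simp only [hgx, hhx, LinearMap.id_comp, LinearMap.comp_id]
  · filter_upwards [hV, hW] with y h1 h2 r w hw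
    exact h1 r _ (hF r _ (h2 r w hw))

theorem SecAt.pi {κ : Type*} [Finite κ] {M : κ → Type*} [∀ a, AddCommGroup (M a)]
    [∀ a, Module ℂ (M a)] {ψ : ∀ a, X → Submodule ℂ (M a)} (h : ∀ a, S.SecAt x (ψ a)) :
    S.SecAt x fun y => Submodule.pi Set.univ fun a => ψ a y := by
  intro v hv
  choose σ h1 h2 h3 using fun a => h a (v a) (hv a trivial)
  exact ⟨fun y a => σ a y, regAt_pi.2 h1, funext h2,
    (eventually_all.2 h3).mono fun y hy a _ => hy a⟩

/-- For a surjective linear map `D`, subspaces `N y` and `P y` with `D (N y) ⊆ P y` that have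
regular sections, the quotients of the preimages of the `P y` by the `N y` have a regular frame. -/
theorem exists_quotient_frame {D : V →ₗ[ℂ] W} (hD : Function.Surjective D)
    {N : X → Submodule ℂ V} {P : X → Submodule ℂ W} (hNP : ∀ y, N y ≤ (P y).comap D)
    {p q : ℕ} (hp : ∀ y, Module.finrank ℂ (V ⧸ N y) = p) (hq : ∀ y, Module.finrank ℂ (W ⧸ P y) = q)
    (hN : S.SecAt x N) (hP : S.SecAt x P) :
    ∃ (n : ℕ) (k : X → Fin n → V), n + q = p ∧ (∀ j, S.RegAt x fun y => k y j) ∧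
      ∀ᶠ y in S.nhds x, (∀ j, k y j ∈ (P y).comap D) ∧
        ∀ z ∈ (P y).comap D, ∃! c : Fin n → ℂ, z - Fintype.linearCombination ℂ (k y) c ∈ N y := by
  classical
  obtain ⟨R, hR⟩ := D.exists_rightInverse_of_surjective (LinearMap.range_eq_top.2 hD)
  have hR' : ∀ w, D (R w) = w := fun w => LinearMap.congr_fun hR w
  -- With a linear section `R` of `D`, the image of `z` is corrected to a section of `P`.
  have hZ : S.SecAt x fun y => (P y).comap D := by
    intro z hz
    obtain ⟨σ, h1, h2, h3⟩ := hP (D z) hz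
    refine ⟨fun y => z - R (D z - σ y), (RegAt.const z).sub (((RegAt.const _).sub h1).map R), ?_, ?_⟩
    · simp [h2]
    · refine h3.mono fun y hy => ?_
      simp only [Submodule.mem_comap, map_sub, hR']
      simpa using hy
  have hZdim : ∀ y, Module.finrank ℂ ((P y).comap D) + q = Module.finrank ℂ V := by
    intro y
    have h1 := (((P y).mkQ ∘ₗ D).quotKerEquivOfSurjective
      ((Submodule.mkQ_surjective _).comp hD)).finrank_eq
    rw [LinearMap.ker_comp, Submodule.ker_mkQ, hq] at h1
    rw [← h1, add_comm, Submodule.finrank_quotient_add_finrank]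
  have hNdim : ∀ y, Module.finrank ℂ (N y) + p = Module.finrank ℂ V := fun y => by
    rw [← hp y, add_comm, Submodule.finrank_quotient_add_finrank]
  obtain ⟨ν, ν1, -, ν3⟩ := hN.exists_frame (k := Module.finrank ℂ V - p) fun y => by
    have := hNdim y
    omega
  -- A basis of a complement `K` of `N x` in the preimage of `P x`, extended by regular sections, is
  -- the frame. Its size is `p - q`, by surjectivity of `D`.
  obtain ⟨K, hK1, hK2⟩ := IsModularLattice.exists_disjoint_and_sup_eq (hNP x)
  have hKZ : K ≤ (P x).comap D := hK2 ▸ le_sup_right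
  let b := Module.finBasis ℂ K
  choose σ h1 h2 h3 using fun j => hZ (b j) (hKZ (b j).2)
  have hKdim : Module.finrank ℂ K + q = p := by
    have h4 := Submodule.finrank_sup_add_finrank_inf_eq (N x) K
    rw [hK2, hK1.eq_bot, finrank_bot] at h4
    have := hZdim x
    have := hNdim x
    omega
  let A : X → ((Fin (Module.finrank ℂ V - p) → ℂ) × (Fin (Module.finrank ℂ K) → ℂ)) →ₗ[ℂ] V :=
    fun y => (Fintype.linearCombination ℂ (ν y)).coprod
      (Fintype.linearCombination ℂ fun j => σ j y)
  have hA : S.RegAt x A := by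
    rw [regAt_linearMap]
    rintro ⟨c, c'⟩
    exact (regAt_linearMap.1 (RegAt.linearCombination ν1) c).add
      (regAt_linearMap.1 (RegAt.linearCombination h1) c')
  have hmemN : ∀ y, Submodule.span ℂ (Set.range (ν y)) = N y → ∀ z,
      z ∈ N y ↔ ∃ c, Fintype.linearCombination ℂ (ν y) c = z := by
    intro y hy z
    rw [← hy, ← Fintype.range_linearCombination ℂ]
    rfl
  have hAx : Function.Injective (A x) := by
    rw [← LinearMap.ker_eq_bot, LinearMap.ker_eq_bot']
    rintro ⟨c, c'⟩ h
    have hc : Fintype.linearCombination ℂ (ν x) c ∈ N x :=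
      (hmemN x (S.self_of_nhds ν3).2 _).2 ⟨c, rfl⟩
    have hc' : Fintype.linearCombination ℂ (fun j => σ j x) c' ∈ K := by
      simp only [h2, Fintype.linearCombination_apply]
      exact sum_mem fun j _ => Submodule.smul_mem _ _ (b j).2
    have h : Fintype.linearCombination ℂ (ν x) c +
      Fintype.linearCombination ℂ (fun j => σ j x) c' = 0 := h
    have hz : Fintype.linearCombination ℂ (fun j => σ j x) c' = 0 := by
      refine (Submodule.disjoint_def.1 hK1) _ ?_ hc'
      rw [← neg_eq_of_add_eq_zero_right h]
      exact neg_mem hc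
    rw [hz, add_zero] at h
    have i1 := linearIndependent_iff_injective_fintypeLinearCombination.1 (S.self_of_nhds ν3).1
    have i2 : Function.Injective (Fintype.linearCombination ℂ (fun j => σ j x)) := by
      rw [← linearIndependent_iff_injective_fintypeLinearCombination]
      simp only [h2]
      exact b.linearIndependent.map' (Submodule.subtype _) (Submodule.ker_subtype _)
    rw [i1 (h.trans (map_zero _).symm), i2 (hz.trans (map_zero _).symm)]
    rfl
  refine ⟨_, fun y j => σ j y, hKdim, h1, ?_⟩
  filter_upwards [hA.eventually_injective hAx, eventually_all.2 h3, ν3] with y i1 i2 i3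
  -- The frame of `N y` together with the new sections stays independent near `x`, so it is a basis
  -- of the preimage of `P y` by dimension count. Unique coordinates modulo `N y` follow.
  have hrange : LinearMap.range (A y) = (P y).comap D := by
    apply Submodule.eq_of_le_of_finrank_eq
    · rintro _ ⟨⟨c, c'⟩, rfl⟩
      refine add_mem (hNP y ((hmemN y i3.2 _).2 ⟨c, rfl⟩)) ?_
      show Fintype.linearCombination ℂ (fun j => σ j y) c' ∈ _
      rw [Fintype.linearCombination_apply]
      exact sum_mem fun j _ => Submodule.smul_mem _ _ (i2 j)
    · rw [LinearMap.finrank_range_of_inj i1]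
      have := hZdim y
      have := hNdim y
      simp only [Module.finrank_prod, Module.finrank_fintype_fun_eq_card, Fintype.card_fin]
      omega
  refine ⟨i2, fun z hz => ?_⟩
  rw [← hrange] at hz
  obtain ⟨⟨c, c'⟩, rfl⟩ := hz
  have hAy : A y (c, c') = Fintype.linearCombination ℂ (ν y) c +
      Fintype.linearCombination ℂ (fun j => σ j y) c' := rfl
  refine ⟨c', ?_, fun e he => ?_⟩
  · simp only [hAy, add_sub_cancel_right]
    exact (hmemN y i3.2 _).2 ⟨c, rfl⟩
  · obtain ⟨c₂, hc₂⟩ := (hmemN y i3.2 _).1 he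
    have : A y (c₂, e) = A y (c, c') := by
      show Fintype.linearCombination ℂ (ν y) c₂ + _ = _
      rw [hc₂]
      exact sub_add_cancel _ _
    exact congrArg Prod.snd (i1 this)

end SpaceWithFunctions

/-! ### Extensions of representations and the differential -/

namespace QuiverRep

variable {I : Type u} [Quiver.{v} I]

/-- A morphism of representations from linear maps that commute with the arrows. -/
def homMk {V W : QuiverRep.{u, v, w} I} (f : ∀ i, V.space i →ₗ[ℂ] W.space i)
    (hf : ∀ (i j : I) (h : i ⟶ j) (x : V.space i), f j (V.arrow h x) = W.arrow h (f i x)) :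
    V ⟶ W :=
  let φ : ∀ a : Paths I, V.obj a ⟶ W.obj a := fun a => ⟨ModuleCat.ofHom (f a)⟩
  { app := φ
    naturality := by
      intro a b p
      induction p using Paths.induction with
      | id => simp
      | comp p q ih =>
        have h1 : V.map ((Paths.of I).map q) ≫ φ _ = φ _ ≫ W.map ((Paths.of I).map q) :=
          FGModuleCat.hom_ext (LinearMap.ext fun x => hf _ _ q x)
        rw [V.map_comp, W.map_comp, Category.assoc, h1, ← Category.assoc, ih, Category.assoc] }

/-- The representation on `V ⊕ W` whose arrows are those of `V` and `W` plus off-diagonal maps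
`W i → V j`. -/
noncomputable def twistedSum (V W : QuiverRep.{u, v, w} I)
    (ξ : ∀ i j : I, (i ⟶ j) → W.space i →ₗ[ℂ] V.space j) : QuiverRep.{u, v, w} I :=
  Paths.lift
    { obj := fun i => FGModuleCat.of ℂ (V.space i × W.space i)
      map := fun {i j} h => FGModuleCat.ofHom
        (((V.arrow h).coprod (ξ i j h)).prod (W.arrow h ∘ₗ LinearMap.snd ℂ _ _)) }

theorem twistedSum_arrow (V W : QuiverRep.{u, v, w} I)
    (ξ : ∀ i j : I, (i ⟶ j) → W.space i →ₗ[ℂ] V.space j) {i j : I} (h : i ⟶ j)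
    (x : V.space i × W.space i) :
    (twistedSum V W ξ).arrow h x = (V.arrow h x.1 + ξ i j h x.2, W.arrow h x.2) := by
  have h1 : (twistedSum V W ξ).map ((Paths.of I).map h) = FGModuleCat.ofHom
        (((V.arrow h).coprod (ξ i j h)).prod (W.arrow h ∘ₗ LinearMap.snd ℂ _ _)) :=
    Paths.lift_toPath _ h
  exact congrArg (fun m => m.hom.hom x) h1

/-- Homology in a functor category is computed objectwise, and the forgetful functor from
`FGModuleCat` to modules detects exactness. -/
theorem shortExact_of_atVertex {S : ShortComplex (QuiverRep.{u, v, w} I)}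
    (h1 : ∀ i, Function.Injective (atVertex S.f i))
    (h2 : ∀ i, Function.Exact (atVertex S.f i) (atVertex S.g i))
    (h3 : ∀ i, Function.Surjective (atVertex S.g i)) : S.ShortExact := by
  have hex : S.Exact := by
    rw [ShortComplex.exact_iff_isZero_homology, Functor.isZero_iff]
    intro i
    have h4 : (S.map ((evaluation (Paths I) (FGModuleCat.{w} ℂ)).obj i)).Exact := by
      rw [← ShortComplex.exact_map_iff_of_faithful _ (forget₂ (FGModuleCat.{w} ℂ) (ModuleCat.{w} ℂ)),
        ShortComplex.ShortExact.moduleCat_exact_iff_function_exact]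
      exact h2 i
    rw [ShortComplex.exact_iff_isZero_homology] at h4
    exact h4.of_iso (S.mapHomologyIso ((evaluation (Paths I) (FGModuleCat.{w} ℂ)).obj i)).symm
  have hm : ∀ i, Mono (S.f.app i) := fun i => ConcreteCategory.mono_of_injective _ (h1 i)
  have he : ∀ i, Epi (S.g.app i) := fun i => ConcreteCategory.epi_of_surjective _ (h3 i)
  exact { exact := hex
          mono_f := NatTrans.mono_of_mono_app _
          epi_g := NatTrans.epi_of_epi_app _ }

/-- In the long exact sequence for `Hom(S.X₃, -)` the obstruction to lifting the identity of `S.X₃`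
lies in a vanishing Ext group. -/
theorem ExtOneVanishes.exists_section {S : ShortComplex (QuiverRep.{u, v, w} I)}
    (hS : S.ShortExact) (hExt : ExtOneVanishes S.X₃ S.X₁) : ∃ s : S.X₃ ⟶ S.X₂, s ≫ S.g = 𝟙 _ := by
  let _ := HasExt.standard (QuiverRep.{u, v, w} I)
  have h1 : Subsingleton (Abelian.Ext S.X₃ S.X₁ 1) := hExt
  obtain ⟨x, hx⟩ := Abelian.Ext.covariant_sequence_exact₃ S.X₃ hS (Abelian.Ext.mk₀ (𝟙 S.X₃))
    (zero_add 1) (Subsingleton.elim _ _)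
  obtain ⟨s, rfl⟩ := Abelian.Ext.addEquiv₀.symm.surjective x
  refine ⟨s, ?_⟩
  apply Abelian.Ext.addEquiv₀.symm.injective
  simpa using hx

/-- The differential on families of linear maps, whose kernel consists of the morphisms. -/
def differential (W V : QuiverRep.{u, v, w} I) :
    (∀ i, W.space i →ₗ[ℂ] V.space i) →ₗ[ℂ] (∀ i j : I, (i ⟶ j) → W.space i →ₗ[ℂ] V.space j) where
  toFun F := fun i j h => V.arrow h ∘ₗ F i - F j ∘ₗ W.arrow h
  map_add' F G := by
    funext i j h
    ext x
    simp only [Pi.add_apply, LinearMap.sub_apply, LinearMap.comp_apply, LinearMap.add_apply,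
      map_add]
    abel
  map_smul' c F := by
    funext i j h
    ext x
    simp only [Pi.smul_apply, LinearMap.sub_apply, LinearMap.comp_apply, LinearMap.smul_apply,
      map_smul, RingHom.id_apply, smul_sub]

theorem differential_apply {W V : QuiverRep.{u, v, w} I} (F : ∀ i, W.space i →ₗ[ℂ] V.space i)
    {i j : I} (h : i ⟶ j) (x : W.space i) :
    differential W V F i j h x = V.arrow h (F i x) - F j (W.arrow h x) := rfl

/-- If `Ext¹(W, V) = 0` then the differential is surjective. -/
theorem ExtOneVanishes.differential_surjective {W V : QuiverRep.{u, v, w} I}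
    (hExt : ExtOneVanishes W V) : Function.Surjective (differential W V) := by
  intro ξ
  let E := twistedSum V W ξ
  let f : V ⟶ E := homMk (W := E) (fun i => LinearMap.inl ℂ (V.space i) (W.space i)) (by
    intro i j h x
    refine Eq.trans ?_ (twistedSum_arrow V W ξ h (x, 0)).symm
    have h1 : V.arrow h x = V.arrow h x + ξ i j h 0 := by rw [map_zero, add_zero]
    exact Prod.ext h1 (map_zero (W.arrow h)).symm)
  let g : E ⟶ W := homMk (V := E) (fun i => LinearMap.snd ℂ (V.space i) (W.space i)) (by
    intro i j h x
    exact congrArg Prod.snd (twistedSum_arrow V W ξ h x))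
  let T : ShortComplex (QuiverRep.{u, v, w} I) := ShortComplex.mk f g (by
    ext i x
    rfl)
  have hT : T.ShortExact := shortExact_of_atVertex
    (fun i => LinearMap.inl_injective (R := ℂ) (M := V.space i) (M₂ := W.space i))
    (fun i => Function.Exact.inl_snd (R := ℂ) (M := V.space i) (N := W.space i))
    (fun i => LinearMap.snd_surjective (R := ℂ) (M := V.space i) (M₂ := W.space i))
  -- Compatibility of the section `x ↦ (G x, x)` with the twisted arrows reads `G_j W_h = V_h G_i +
  -- ξ_h`, so `-G` is a preimage of `ξ`.
  obtain ⟨s, hs⟩ := ExtOneVanishes.exists_section hT hExt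
  have hs' : ∀ i (x : W.space i), ((atVertex s i x : V.space i × W.space i)).2 = x := fun i x =>
    congrArg (fun m : W ⟶ W => atVertex m i x) hs
  let G : ∀ i, W.space i →ₗ[ℂ] V.space i := fun i =>
    LinearMap.fst ℂ (V.space i) (W.space i) ∘ₗ
      (show W.space i →ₗ[ℂ] V.space i × W.space i from atVertex s i)
  refine ⟨fun i => -G i, ?_⟩
  funext i j h
  ext x
  have h1 := (atVertex_arrow s h x).trans (twistedSum_arrow V W ξ h (atVertex s i x))
  have h2 := congrArg Prod.fst h1
  simp only [hs'] at h2
  have h3 : G j (W.arrow h x) = V.arrow h (G i x) + ξ i j h x := h2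
  rw [differential_apply, LinearMap.neg_apply, LinearMap.neg_apply, h3, map_neg]
  abel

end QuiverRep

/-! ### Codimensions in terms of flag types, and the Euler form -/

namespace QuiverRep

variable {I : Type u} [Quiver.{v} I]

theorem IsFlag.monotone {V : QuiverRep.{u, v, w} I} {d : ℕ} {t : Fin d → I → ℕ}
    {L : ∀ a : Fin d × I, Submodule ℂ (V.space a.2)} (h : IsFlag V t L) (i : I) :
    Monotone (α := Fin d) (β := Submodule ℂ (V.space i)) fun r => L (r, i) :=
  fun r s hrs => h.mono r s hrs i

theorem IsFlag.exists_isAdapted {V : QuiverRep.{u, v, w} I} {d : ℕ} (hd : 0 < d)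
    {t : Fin d → I → ℕ} {L : ∀ a : Fin d × I, Submodule ℂ (V.space a.2)} (h : IsFlag V t L)
    (i : I) : ∃ (b : Module.Basis (Fin (Module.finrank ℂ (V.space i))) ℂ (V.space i))
      (lev : Fin (Module.finrank ℂ (V.space i)) → Fin d), IsAdapted (fun r => L (r, i)) b lev :=
  _root_.exists_isAdapted _ (h.monotone i) hd fun r hr => h.last r hr i

/-- The number of adapted basis vectors entering at a step depends only on the flag type. This is
why all codimensions below are constant along the base. -/
theorem IsFlag.flagTypeStep_eq {V : QuiverRep.{u, v, w} I} {d : ℕ} {t : Fin d → I → ℕ}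
    {L : ∀ a : Fin d × I, Submodule ℂ (V.space a.2)} (h : IsFlag V t L) {i : I} {n : ℕ}
    {b : Module.Basis (Fin n) ℂ (V.space i)} {lev : Fin n → Fin d}
    (hb : IsAdapted (fun r => L (r, i)) b lev) (r : Fin d) :
    flagTypeStep t r i = ((Finset.univ.filter fun j => lev j = r).card : ℤ) := by
  classical
  have h1 : ∀ r, t r i = (Finset.univ.filter fun j => lev j ≤ r).card := fun r => by
    rw [← h.dim r i, hb.card_le r]
  unfold flagTypeStep
  split_ifs with h0
  · rw [h1]
    congr 2
    ext j
    simp only [Finset.mem_filter, Finset.mem_univ, true_and, Fin.le_def, Fin.ext_iff]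
    omega
  · rw [h1, h1, sub_eq_iff_eq_add]
    norm_cast
    rw [← Finset.card_union_of_disjoint]
    · congr 1
      ext j
      simp only [Finset.mem_filter, Finset.mem_univ, true_and, Finset.mem_union, Fin.le_def,
        Fin.ext_iff]
      omega
    · rw [Finset.disjoint_filter]
      intro j _ h2 h3
      rw [h2, Fin.le_def] at h3
      simp only at h3
      omega

section FilteredFamilies

variable {V W : QuiverRep.{u, v, w} I} {d : ℕ}

/-- The families of linear maps that respect two families of filtrations. -/
def homFil (LV : ∀ a : Fin d × I, Submodule ℂ (V.space a.2))
    (LW : ∀ a : Fin d × I, Submodule ℂ (W.space a.2)) :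
    Submodule ℂ (∀ i, W.space i →ₗ[ℂ] V.space i) :=
  Submodule.pi Set.univ fun i => filteredMaps (fun r => LW (r, i)) (fun r => LV (r, i))

/-- The families of linear maps indexed by the arrows that respect two families of filtrations. -/
def arrowFil (LV : ∀ a : Fin d × I, Submodule ℂ (V.space a.2))
    (LW : ∀ a : Fin d × I, Submodule ℂ (W.space a.2)) :
    Submodule ℂ (∀ i j : I, (i ⟶ j) → W.space i →ₗ[ℂ] V.space j) :=
  Submodule.pi Set.univ fun i => Submodule.pi Set.univ fun j => Submodule.pi Set.univ fun _ =>
    filteredMaps (fun r => LW (r, i)) (fun r => LV (r, j))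

variable {LV : ∀ a : Fin d × I, Submodule ℂ (V.space a.2)}
  {LW : ∀ a : Fin d × I, Submodule ℂ (W.space a.2)}

theorem mem_homFil {F : ∀ i, W.space i →ₗ[ℂ] V.space i} :
    F ∈ homFil LV LW ↔ ∀ i r, ∀ x ∈ LW (r, i), F i x ∈ LV (r, i) :=
  ⟨fun h i => h i trivial, fun h i _ => h i⟩

theorem mem_arrowFil {F : ∀ i j : I, (i ⟶ j) → W.space i →ₗ[ℂ] V.space j} :
    F ∈ arrowFil LV LW ↔ ∀ i j h r, ∀ x ∈ LW (r, i), F i j h x ∈ LV (r, j) :=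
  ⟨fun h i j k => h i trivial j trivial k trivial, fun h i _ j _ k _ => h i j k⟩

/-- The steps of both flags are stable under the arrows, so each of the two terms of the
differential respects the filtrations. -/
theorem homFil_le {tV tW : Fin d → I → ℕ} (hV : IsFlag V tV LV) (hW : IsFlag W tW LW) :
    homFil LV LW ≤ (arrowFil LV LW).comap (differential W V) := by
  intro F hF
  rw [Submodule.mem_comap, mem_arrowFil]
  rw [mem_homFil] at hF
  intro i j h r x hx
  rw [differential_apply]
  exact sub_mem (hV.subrep r i j h ⟨_, hF i r x hx, rfl⟩)
    (hF j r _ (hW.subrep r i j h ⟨x, hx, rfl⟩))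

theorem finrank_quotient_pi {κ : Type*} [Fintype κ] {M : κ → Type*} [∀ a, AddCommGroup (M a)]
    [∀ a, Module ℂ (M a)] [∀ a, Module.Finite ℂ (M a)] (L : ∀ a, Submodule ℂ (M a)) :
    Module.finrank ℂ ((∀ a, M a) ⧸ Submodule.pi Set.univ L) =
      ∑ a, Module.finrank ℂ (M a ⧸ L a) := by
  classical
  rw [(Submodule.quotientPi L).finrank_eq, Module.finrank_pi_fintype]

theorem finrank_quotient_filteredMaps_flag (hd : 0 < d) {tV tW : Fin d → I → ℕ}
    (hV : IsFlag V tV LV) (hW : IsFlag W tW LW) (i j : I) :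
    (Module.finrank ℂ ((W.space i →ₗ[ℂ] V.space j) ⧸
      filteredMaps (fun r => LW (r, i)) (fun r => LV (r, j))) : ℤ) =
      ∑ r : Fin d, ∑ t ∈ Finset.Ioi r, flagTypeStep tW r i * flagTypeStep tV t j := by
  obtain ⟨bW, levW, h1⟩ := hW.exists_isAdapted hd i
  obtain ⟨bV, levV, h2⟩ := hV.exists_isAdapted hd j
  rw [finrank_quotient_filteredMaps h1 h2]
  push_cast
  refine Finset.sum_congr rfl fun r _ => Finset.sum_congr rfl fun t _ => ?_
  rw [hW.flagTypeStep_eq h1, hV.flagTypeStep_eq h2]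

variable [Fintype I]

theorem finrank_quotient_homFil (hd : 0 < d) {tV tW : Fin d → I → ℕ}
    (hV : IsFlag V tV LV) (hW : IsFlag W tW LW) :
    (Module.finrank ℂ ((∀ i, W.space i →ₗ[ℂ] V.space i) ⧸ homFil LV LW) : ℤ) =
      ∑ i, ∑ r : Fin d, ∑ t ∈ Finset.Ioi r, flagTypeStep tW r i * flagTypeStep tV t i := by
  unfold homFil
  rw [finrank_quotient_pi]
  push_cast
  exact Finset.sum_congr rfl fun i _ => finrank_quotient_filteredMaps_flag hd hV hW i i

variable [∀ i j : I, Fintype (i ⟶ j)]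

theorem finrank_quotient_arrowFil (hd : 0 < d) {tV tW : Fin d → I → ℕ}
    (hV : IsFlag V tV LV) (hW : IsFlag W tW LW) :
    (Module.finrank ℂ ((∀ i j : I, (i ⟶ j) → W.space i →ₗ[ℂ] V.space j) ⧸ arrowFil LV LW) : ℤ) =
      ∑ i, ∑ j, ∑ _h : i ⟶ j, ∑ r : Fin d, ∑ t ∈ Finset.Ioi r,
        flagTypeStep tW r i * flagTypeStep tV t j := by
  unfold arrowFil
  rw [finrank_quotient_pi]
  push_cast
  refine Finset.sum_congr rfl fun i _ => ?_
  rw [finrank_quotient_pi]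
  push_cast
  refine Finset.sum_congr rfl fun j _ => ?_
  rw [finrank_quotient_pi]
  push_cast
  exact Finset.sum_congr rfl fun h _ => finrank_quotient_filteredMaps_flag hd hV hW i j

theorem sum_eulerForm (a b : Fin d → I → ℤ) :
    ∑ r : Fin d, ∑ t ∈ Finset.Ioi r, eulerForm I (a r) (b t) =
      ∑ i, ∑ r : Fin d, ∑ t ∈ Finset.Ioi r, a r i * b t i -
        ∑ i, ∑ j, ∑ _h : i ⟶ j, ∑ r : Fin d, ∑ t ∈ Finset.Ioi r, a r i * b t j := by
  have key : ∀ {κ : Type _} [Fintype κ] (f : Fin d → Fin d → κ → ℤ),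
      ∑ r : Fin d, ∑ t ∈ Finset.Ioi r, ∑ i, f r t i =
        ∑ i, ∑ r : Fin d, ∑ t ∈ Finset.Ioi r, f r t i := fun f =>
    (Finset.sum_congr rfl fun r _ => Finset.sum_comm).trans Finset.sum_comm
  simp only [eulerForm, Finset.sum_sub_distrib]
  congr 1
  · exact key _
  · refine (key _).trans (Finset.sum_congr rfl fun i _ => ?_)
    refine (key _).trans (Finset.sum_congr rfl fun j _ => ?_)
    exact (Finset.sum_congr rfl fun r _ => Finset.sum_comm).trans Finset.sum_comm

end FilteredFamilies

/-! ### Flags in a split extension as graphs -/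

section Twist

variable {S : ShortComplex (QuiverRep.{u, v, w} I)} (σ : S.Splitting) {d : ℕ}

theorem r_f_apply (i : I) (x : S.X₁.space i) : atVertex σ.r i (atVertex S.f i x) = x :=
  congrArg (fun m : S.X₁ ⟶ S.X₁ => atVertex m i x) σ.f_r

theorem g_s_apply (i : I) (x : S.X₃.space i) : atVertex S.g i (atVertex σ.s i x) = x :=
  congrArg (fun m : S.X₃ ⟶ S.X₃ => atVertex m i x) σ.s_g

theorem r_s_apply (i : I) (x : S.X₃.space i) : atVertex σ.r i (atVertex σ.s i x) = 0 :=
  congrArg (fun m : S.X₃ ⟶ S.X₁ => atVertex m i x) σ.s_r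

theorem g_f_apply (i : I) (x : S.X₁.space i) : atVertex S.g i (atVertex S.f i x) = 0 :=
  congrArg (fun m : S.X₁ ⟶ S.X₃ => atVertex m i x) S.zero

theorem f_r_add_s_g_apply (i : I) (x : S.X₂.space i) :
    atVertex S.f i (atVertex σ.r i x) + atVertex σ.s i (atVertex S.g i x) = x :=
  congrArg (fun m : S.X₂ ⟶ S.X₂ => atVertex m i x) σ.id

variable (F F' : ∀ i, S.X₃.space i →ₗ[ℂ] S.X₁.space i)
  (LV : ∀ a : Fin d × I, Submodule ℂ (S.X₁.space a.2))
  (LW : ∀ a : Fin d × I, Submodule ℂ (S.X₃.space a.2))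

/-- The family of subspaces of the middle term of a split sequence that lies over given families in
the outer terms and is the graph of `F` modulo the left hand one. -/
def twist (a : Fin d × I) : Submodule ℂ (S.X₂.space a.2) :=
  (LW a).comap (atVertex S.g a.2) ⊓
    (LV a).comap (atVertex σ.r a.2 - F a.2 ∘ₗ atVertex S.g a.2)

variable {F F' LV LW}

theorem mem_twist {a : Fin d × I} {x : S.X₂.space a.2} :
    x ∈ twist σ F LV LW a ↔ atVertex S.g a.2 x ∈ LW a ∧
      atVertex σ.r a.2 x - F a.2 (atVertex S.g a.2 x) ∈ LV a := Iff.rfl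

variable (F) in
/-- The vector of the middle term with given components. -/
def graphVector (i : I) (w : S.X₃.space i) (v : S.X₁.space i) : S.X₂.space i :=
  atVertex σ.s i w + atVertex S.f i (F i w + v)

theorem g_graphVector (i : I) (w : S.X₃.space i) (v : S.X₁.space i) :
    atVertex S.g i (graphVector σ F i w v) = w := by
  rw [graphVector, map_add, g_s_apply, g_f_apply, add_zero]

theorem r_graphVector (i : I) (w : S.X₃.space i) (v : S.X₁.space i) :
    atVertex σ.r i (graphVector σ F i w v) = F i w + v := by
  rw [graphVector, map_add, r_s_apply, r_f_apply, zero_add]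

theorem graphVector_mem {a : Fin d × I} {w : S.X₃.space a.2} {v : S.X₁.space a.2} (hw : w ∈ LW a)
    (hv : v ∈ LV a) : graphVector σ F a.2 w v ∈ twist σ F LV LW a := by
  rw [mem_twist, g_graphVector, r_graphVector, add_sub_cancel_left]
  exact ⟨hw, hv⟩

theorem eq_graphVector (i : I) (x : S.X₂.space i) :
    x = graphVector σ F i (atVertex S.g i x) (atVertex σ.r i x - F i (atVertex S.g i x)) := by
  rw [graphVector, add_sub_cancel, add_comm]
  exact (f_r_add_s_g_apply σ i x).symm

theorem interFamily_twist : interFamily S (twist σ F LV LW) = LV := by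
  funext a
  ext x
  show atVertex S.f a.2 x ∈ twist σ F LV LW a ↔ _
  rw [mem_twist, g_f_apply, r_f_apply, map_zero, sub_zero]
  exact ⟨fun h => h.2, fun h => ⟨zero_mem _, h⟩⟩

theorem imageFamily_twist : imageFamily S (twist σ F LV LW) = LW := by
  funext a
  ext x
  constructor
  · rintro ⟨z, hz, rfl⟩
    exact hz.1
  · intro hx
    exact ⟨_, graphVector_mem σ hx (zero_mem (LV a)), g_graphVector σ _ _ _⟩

/-- For stability under an arrow `h`: if `v = r x - F (g x)` is the deviation of `x` from the graph,
then that of its image is `V_h v + (D F)_h (g x)`, and both summands lie in the flag of `V`. -/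
theorem isFlag_twist (hS : S.ShortExact) {tV tW : Fin d → I → ℕ} (hV : IsFlag S.X₁ tV LV)
    (hW : IsFlag S.X₃ tW LW) (hF : differential S.X₃ S.X₁ F ∈ arrowFil LV LW) :
    IsFlag S.X₂ (tV + tW) (twist σ F LV LW) where
  subrep r i j h := by
    rintro _ ⟨x, hx, rfl⟩
    have hx' := (mem_twist σ).1 hx
    refine (mem_twist σ).2 ?_
    have h1 := atVertex_arrow S.g h x
    have h2 := atVertex_arrow σ.r h x
    refine ⟨?_, ?_⟩
    · show atVertex S.g j (S.X₂.arrow h x) ∈ LW (r, j)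
      rw [h1]
      exact hW.subrep r i j h ⟨_, hx'.1, rfl⟩
    · show atVertex σ.r j (S.X₂.arrow h x) - F j (atVertex S.g j (S.X₂.arrow h x)) ∈ LV (r, j)
      rw [h1, h2]
      have h3 := hV.subrep r i j h ⟨_, hx'.2, rfl⟩
      have h4 := mem_arrowFil.1 hF i j h r _ hx'.1
      rw [differential_apply] at h4
      have h5 := add_mem h3 h4
      rw [map_sub, sub_add_sub_cancel] at h5
      exact h5
  mono r s hrs i x hx := ⟨hW.mono r s hrs i hx.1, hV.mono r s hrs i hx.2⟩
  last r hr i := by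
    refine eq_top_iff.2 fun x _ => (mem_twist σ).2 ⟨?_, ?_⟩
    · rw [hW.last r hr i]
      trivial
    · rw [hV.last r hr i]
      trivial
  dim r i := by
    rw [← finrank_comap_add_finrank_map (atVertex S.f i) (atVertex S.g i)
      (shortExact_atVertex hS i).1 (shortExact_atVertex hS i).2.1]
    have h1 := congrFun (interFamily_twist σ (F := F) (LV := LV) (LW := LW)) (r, i)
    have h2 := congrFun (imageFamily_twist σ (F := F) (LV := LV) (LW := LW)) (r, i)
    unfold interFamily at h1
    unfold imageFamily at h2
    rw [h1, h2, hV.dim, hW.dim]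
    rfl

/-- The vector of the graph of `F` over `w` deviates from the graph of `F'` by `(F - F') w`. -/
theorem twist_eq_iff : twist σ F LV LW = twist σ F' LV LW ↔ F - F' ∈ homFil LV LW := by
  rw [mem_homFil]
  constructor
  · intro h i r w hw
    have h1 : graphVector σ F i w 0 ∈ twist σ F LV LW (r, i) :=
      graphVector_mem σ (a := (r, i)) hw (zero_mem (LV (r, i)))
    rw [h, mem_twist, g_graphVector, r_graphVector, add_zero] at h1
    exact h1.2
  · intro h
    funext a
    ext x
    rw [mem_twist, mem_twist]
    refine and_congr_right fun hx => ?_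
    have h1 := h a.2 a.1 _ hx
    have h2 : atVertex σ.r a.2 x - F a.2 (atVertex S.g a.2 x) +
        (F - F') a.2 (atVertex S.g a.2 x) =
        atVertex σ.r a.2 x - F' a.2 (atVertex S.g a.2 x) := by
      simp only [Pi.sub_apply, LinearMap.sub_apply]
      abel
    rw [← h2]
    exact (Submodule.add_mem_iff_left _ h1).symm

/-- Every flag in the middle term arises as a twist. -/
theorem exists_twist_eq (hS : S.ShortExact) (hd : 0 < d) {tV tW : Fin d → I → ℕ}
    {φ : S.X₂.FlagAmbient (tV + tW)} (hφ : φ ∈ extFlags S tV tW) :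
    ∃ F, differential S.X₃ S.X₁ F ∈ arrowFil (interFamily S φ.1) (imageFamily S φ.1) ∧
      twist σ F (interFamily S φ.1) (imageFamily S φ.1) = φ.1 := by
  have hW := isFlag_imageFamily tV tW hS hφ
  choose b lev hb using hW.exists_isAdapted hd
  choose x hx hxb using fun i j => (hb i).basis_mem j
  -- Each vector of a basis adapted to the image flag is lifted into `φ` at the very step where it
  -- enters; `F` is the left hand component of the lift. Thus the graph of `F` over every step lies
  -- in that step of `φ`.
  let F : ∀ i, S.X₃.space i →ₗ[ℂ] S.X₁.space i := fun i =>
    (b i).constr ℂ fun j => atVertex σ.r i (x i j)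
  have key : ∀ (r : Fin d) (i : I), ∀ w ∈ imageFamily S φ.1 (r, i),
      graphVector σ F i w 0 ∈ φ.1 (r, i) := by
    intro r i
    have h1 : imageFamily S φ.1 (r, i) ≤ (φ.1 (r, i)).comap
        (atVertex σ.s i + atVertex S.f i ∘ₗ F i) := by
      refine (hb i).le_of_forall fun j hj => ?_
      show atVertex σ.s i (b i j) + atVertex S.f i (F i (b i j)) ∈ φ.1 (r, i)
      have h2 : F i (b i j) = atVertex σ.r i (x i j) := Module.Basis.constr_basis _ _ _ _
      have h3 : atVertex σ.s i (b i j) + atVertex S.f i (F i (b i j)) = x i j := by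
        rw [h2, ← hxb i j, add_comm]
        exact f_r_add_s_g_apply σ i (x i j)
      rw [h3]
      exact hφ.1.mono _ _ hj i (hx i j)
    intro w hw
    rw [graphVector, add_zero]
    exact h1 hw
  have htw : twist σ F (interFamily S φ.1) (imageFamily S φ.1) = φ.1 := by
    funext a
    apply le_antisymm
    · intro z hz
      rw [eq_graphVector σ (F := F) a.2 z, graphVector, map_add, ← add_assoc]
      refine add_mem ?_ hz.2
      have h1 := key a.1 a.2 _ hz.1
      rwa [graphVector, add_zero] at h1
    · intro z hz
      have hz' : atVertex S.g a.2 z ∈ imageFamily S φ.1 a := ⟨z, hz, rfl⟩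
      refine (mem_twist σ).2 ⟨hz', ?_⟩
      have h1 := key a.1 a.2 _ hz'
      have h2 := sub_mem hz h1
      nth_rewrite 1 [eq_graphVector σ (F := F) a.2 z] at h2
      rw [graphVector, graphVector, add_zero, map_add, add_sub_add_left_eq_sub,
        add_sub_cancel_left] at h2
      exact h2
  refine ⟨F, ?_, htw⟩
  rw [mem_arrowFil]
  intro i j h r w hw
  -- The image under `h` of the graph vector over `w` lies in `φ`, and its deviation from the graph
  -- is exactly `(D F)_h w`.
  have h1 := hφ.1.subrep r i j h ⟨_, key r i w hw, rfl⟩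
  rw [← htw, mem_twist] at h1
  have h2 := h1.2
  have h3 := atVertex_arrow S.g h (graphVector σ F i w 0)
  have h4 := atVertex_arrow σ.r h (graphVector σ F i w 0)
  rw [g_graphVector] at h3
  rw [r_graphVector, add_zero] at h4
  have h5 : atVertex σ.r j (S.X₂.arrow h (graphVector σ F i w 0)) -
    F j (atVertex S.g j (S.X₂.arrow h (graphVector σ F i w 0))) ∈ interFamily S φ.1 (r, j) := h2
  rw [h3, h4] at h5
  exact h5

end Twist

end QuiverRep

namespace QuiverRep

open SpaceWithFunctions

variable {I : Type u} [Quiver.{v} I]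

/-! ### Regularity of graphs and of their coordinates -/

section Regularity

variable {S : ShortComplex (QuiverRep.{u, v, w} I)} {d : ℕ} (σ : S.Splitting)
variable {X : Type*} {SX : SpaceWithFunctions X} {x : X}

theorem secAt_twist [Finite I] {F : X → ∀ i, S.X₃.space i →ₗ[ℂ] S.X₁.space i}
    (hF : SX.RegAt x F)
    {LV : X → ∀ a : Fin d × I, Submodule ℂ (S.X₁.space a.2)}
    {LW : X → ∀ a : Fin d × I, Submodule ℂ (S.X₃.space a.2)} {a : Fin d × I}
    (hV : SX.SecAt x fun y => LV y a) (hW : SX.SecAt x fun y => LW y a) :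
    SX.SecAt x fun y => twist σ (F y) (LV y) (LW y) a := by
  intro z hz
  obtain ⟨p, p1, p2, p3⟩ := hW _ ((mem_twist σ).1 hz).1
  obtain ⟨q, q1, q2, q3⟩ := hV _ ((mem_twist σ).1 hz).2
  refine ⟨fun y => graphVector σ (F y) a.2 (p y) (q y), ?_, ?_, ?_⟩
  · exact (p1.map _).add ((((regAt_pi.1 hF a.2).apply p1).add q1).map _)
  · show graphVector σ (F x) a.2 (p x) (q x) = z
    rw [p2, q2]
    exact (eq_graphVector σ a.2 z).symm
  · filter_upwards [p3, q3] with y h1 h2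
    exact graphVector_mem σ h1 h2

/-- The coordinates of a twist with respect to a regular frame are regular. -/
theorem regAt_coordinates [Finite I] {n : ℕ}
    {k : X → Fin n → ∀ i, S.X₃.space i →ₗ[ℂ] S.X₁.space i}
    (hk : ∀ j, SX.RegAt x fun y => k y j) {c : X → Fin n → ℂ}
    {LV : X → ∀ a : Fin d × I, Submodule ℂ (S.X₁.space a.2)}
    {LW : X → ∀ a : Fin d × I, Submodule ℂ (S.X₃.space a.2)}
    {m : Fin d × I → ℕ}
    (hm : ∀ y a, Module.finrank ℂ
      (twist σ (Fintype.linearCombination ℂ (k y) (c y)) (LV y) (LW y) a) = m a)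
    (hsec : ∀ a, SX.SecAt x fun y =>
      twist σ (Fintype.linearCombination ℂ (k y) (c y)) (LV y) (LW y) a)
    {g : ∀ i, X → S.X₁.space i →ₗ[ℂ] S.X₁.space i} (hg : ∀ i, SX.RegAt x (g i))
    (hgV : ∀ i, ∀ᶠ y in SX.nhds x, ∀ r, ∀ v, v ∈ LV y (r, i) ↔ g i y v ∈ LV x (r, i))
    (hinj : ∀ c, Fintype.linearCombination ℂ (k x) c ∈ homFil (LV x) (LW x) → c = 0) :
    SX.RegAt x c := by
  choose β β1 _ β3 using fun a => (hsec a).exists_frame fun y => hm y a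
  -- Each frame vector `β` of the flag satisfies `r β - ∑ c_j k_j (g β) ∈ LV y a`. The transport
  -- moves this condition into the fixed subspace `LV x a`, so modulo it `c` solves a linear system
  -- in a fixed vector space with regular coefficients.
  let u : Fin n → X → ∀ a : Fin d × I, Fin (m a) → S.X₁.space a.2 ⧸ LV x a :=
    fun j y a l => (LV x a).mkQ (g a.2 y (k y j a.2 (atVertex S.g a.2 (β a y l))))
  have hu : ∀ j, SX.RegAt x (u j) := fun j => regAt_pi.2 fun a => regAt_pi.2 fun l =>
    ((hg a.2).apply ((regAt_pi.1 (hk j) a.2).apply ((β1 a l).map (atVertex S.g a.2)))).map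
      (LV x a).mkQ
  let f : X → ∀ a : Fin d × I, Fin (m a) → S.X₁.space a.2 ⧸ LV x a :=
    fun y a l => (LV x a).mkQ (g a.2 y (atVertex σ.r a.2 (β a y l)))
  have hf : SX.RegAt x f := regAt_pi.2 fun a => regAt_pi.2 fun l =>
    ((hg a.2).apply ((β1 a l).map (atVertex σ.r a.2))).map (LV x a).mkQ
  have hA : ∀ y c a l, Fintype.linearCombination ℂ (fun j => u j y) c a l =
      (LV x a).mkQ (g a.2 y (Fintype.linearCombination ℂ (k y) c a.2
        (atVertex S.g a.2 (β a y l)))) := by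
    intro y c a l
    simp only [Fintype.linearCombination_apply, Finset.sum_apply, Pi.smul_apply,
      LinearMap.sum_apply, LinearMap.smul_apply, map_sum, map_smul, u]
  have hβ : ∀ᶠ y in SX.nhds x, ∀ a, Submodule.span ℂ (Set.range (β a y)) =
      twist σ (Fintype.linearCombination ℂ (k y) (c y)) (LV y) (LW y) a :=
    eventually_all.2 fun a => (β3 a).mono fun y hy => hy.2
  refine RegAt.of_apply_eq (RegAt.linearCombination hu) ?_ hf ?_
  -- A combination in the kernel at `x` maps the image of the flag, that is `LW x`, into `LV x`; it
  -- lies in `homFil` and is therefore trivial.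
  · rw [← LinearMap.ker_eq_bot, LinearMap.ker_eq_bot']
    intro e he
    apply hinj
    rw [mem_homFil]
    intro i r z hz
    have h1 : ∀ l, Fintype.linearCombination ℂ (k x) e i
        (atVertex S.g i (β (r, i) x l)) ∈ LV x (r, i) := by
      intro l
      have h2 := hA x e (r, i) l
      rw [he] at h2
      have h3 := (Submodule.Quotient.mk_eq_zero _).1 h2.symm
      exact (SX.self_of_nhds (hgV i) r _).2 h3
    have h4 : twist σ (Fintype.linearCombination ℂ (k x) (c x)) (LV x) (LW x) (r, i) ≤
        (LV x (r, i)).comap (Fintype.linearCombination ℂ (k x) e i ∘ₗ atVertex S.g i) := by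
      rw [← SX.self_of_nhds hβ, Submodule.span_le]
      rintro _ ⟨l, rfl⟩
      exact h1 l
    have h5 := h4 (graphVector_mem σ hz (zero_mem (LV x (r, i))))
    rw [Submodule.mem_comap, LinearMap.comp_apply, g_graphVector] at h5
    exact h5
  · filter_upwards [hβ, eventually_all.2 hgV] with y h1 h2
    funext a l
    rw [hA, ← sub_eq_zero]
    show _ - (LV x a).mkQ (g a.2 y (atVertex σ.r a.2 (β a y l))) = 0
    rw [← map_sub, ← map_sub]
    refine (Submodule.Quotient.mk_eq_zero _).2 ((h2 a.2 a.1 _).1 ?_)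
    have h3 : β a y l ∈ twist σ (Fintype.linearCombination ℂ (k y) (c y)) (LV y) (LW y) a := by
      rw [← h1]
      exact Submodule.subset_span ⟨l, rfl⟩
    have h4 := neg_mem ((mem_twist σ).1 h3).2
    rwa [neg_sub] at h4

end Regularity

/-! ### Fibres and regular families over the base -/

section Bundle

variable {S : ShortComplex (QuiverRep.{u, v, w} I)} {d : ℕ} {tV tW : Fin d → I → ℕ}

/-- The product of the flag varieties of the outer terms. -/
noncomputable abbrev baseVariety (S : ShortComplex (QuiverRep.{u, v, w} I))
    (tV tW : Fin d → I → ℕ) :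
    SpaceWithFunctions (S.X₁.flags tV × S.X₃.flags tW) :=
  (flagVariety S.X₁ tV).prod (flagVariety S.X₃ tW)

/-- The maps that give rise to flags over a given pair of flags. -/
abbrev liftSpace (y : S.X₁.flags tV × S.X₃.flags tW) :
    Submodule ℂ (∀ i, S.X₃.space i →ₗ[ℂ] S.X₁.space i) :=
  (arrowFil y.1.1.1 y.2.1.1).comap (differential S.X₃ S.X₁)

/-- The maps that give rise to the direct sum flag over a given pair of flags. -/
abbrev trivialLifts (y : S.X₁.flags tV × S.X₃.flags tW) :
    Submodule ℂ (∀ i, S.X₃.space i →ₗ[ℂ] S.X₁.space i) :=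
  homFil y.1.1.1 y.2.1.1

variable (σ : S.Splitting) (hS : S.ShortExact)

/-- The flag over a given pair of flags that is defined by a family of linear maps. -/
def twistFlag (y : S.X₁.flags tV × S.X₃.flags tW) (F : liftSpace y) : extFlags S tV tW :=
  have h := isFlag_twist σ hS y.1.2 y.2.2 F.2
  ⟨⟨twist σ F.1 y.1.1.1 y.2.1.1, fun a => h.dim a.1 a.2⟩, h, by
    rw [interFamily_twist]
    exact y.1.2⟩

theorem extFlagsMap_twistFlag (y : S.X₁.flags tV × S.X₃.flags tW) (F : liftSpace y) :
    extFlagsMap tV tW hS (twistFlag σ hS y F) = y :=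
  Prod.ext (Subtype.ext (Subtype.ext (interFamily_twist σ)))
    (Subtype.ext (Subtype.ext (imageFamily_twist σ)))

theorem twistFlag_eq_iff {y : S.X₁.flags tV × S.X₃.flags tW} {F F' : liftSpace y} :
    twistFlag σ hS y F = twistFlag σ hS y F' ↔ F.1 - F'.1 ∈ trivialLifts y := by
  rw [← twist_eq_iff σ]
  exact ⟨fun h => congrArg (fun φ : extFlags S tV tW => φ.1.1) h,
    fun h => Subtype.ext (Subtype.ext h)⟩

theorem exists_twistFlag_eq (hd : 0 < d) (φ : extFlags S tV tW)
    {y : S.X₁.flags tV × S.X₃.flags tW} (hy : extFlagsMap tV tW hS φ = y) :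
    ∃ F : liftSpace y, twistFlag σ hS y F = φ := by
  subst hy
  obtain ⟨F, h1, h2⟩ := exists_twist_eq σ hS hd φ.2
  exact ⟨⟨F, h1⟩, Subtype.ext (Subtype.ext h2)⟩

/-- The fibres of the map to the pairs of flags are vector spaces. -/
theorem exists_fibreEquiv (hd : 0 < d) (y : S.X₁.flags tV × S.X₃.flags tW) :
    ∃ e : {φ : extFlags S tV tW // extFlagsMap tV tW hS φ = y} ≃
        (liftSpace y ⧸ (trivialLifts y).submoduleOf (liftSpace y)),
      ∀ (φ : {φ : extFlags S tV tW // extFlagsMap tV tW hS φ = y}) (F : liftSpace y),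
        twistFlag σ hS y F = φ.1 → e φ = Submodule.Quotient.mk F := by
  -- The choice of `G` does not matter: families with the same flag have the same class.
  choose G hG using fun φ : {φ : extFlags S tV tW // extFlagsMap tV tW hS φ = y} =>
    exists_twistFlag_eq σ hS hd φ.1 φ.2
  have key : ∀ F F' : liftSpace y, (Submodule.Quotient.mk F :
      liftSpace y ⧸ (trivialLifts y).submoduleOf (liftSpace y)) = Submodule.Quotient.mk F' ↔
      twistFlag σ hS y F = twistFlag σ hS y F' := fun F F' => by
    rw [Submodule.Quotient.eq, twistFlag_eq_iff]
    rfl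
  refine ⟨Equiv.ofBijective (fun φ => Submodule.Quotient.mk (G φ)) ⟨?_, ?_⟩, ?_⟩
  · intro φ φ' h
    have h1 := (key _ _).1 h
    rw [hG, hG] at h1
    exact Subtype.ext h1
  · intro q
    obtain ⟨F, rfl⟩ := Submodule.Quotient.mk_surjective _ q
    refine ⟨⟨twistFlag σ hS y F, extFlagsMap_twistFlag σ hS y F⟩, ?_⟩
    exact (key _ _).2 (hG _)
  · intro φ F h
    exact (key _ _).2 ((hG φ).trans h.symm)

variable [Finite I]

theorem secAt_left (y : S.X₁.flags tV × S.X₃.flags tW) (a : Fin d × I) :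
    (baseVariety S tV tW).SecAt y fun y => y.1.1.1 a :=
  (secAt_grassmannian y.1.1 a).comp_morphAt
    (f := fun y : S.X₁.flags tV × S.X₃.flags tW => y.1.1) (morphAt_val.comp morphAt_fst)

theorem secAt_right (y : S.X₁.flags tV × S.X₃.flags tW) (a : Fin d × I) :
    (baseVariety S tV tW).SecAt y fun y => y.2.1.1 a :=
  (secAt_grassmannian y.2.1 a).comp_morphAt
    (f := fun y : S.X₁.flags tV × S.X₃.flags tW => y.2.1) (morphAt_val.comp morphAt_snd)

theorem secAt_extFlags (φ : extFlags S tV tW) (a : Fin d × I) :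
    (extFlagVariety S tV tW).SecAt φ fun φ => φ.1.1 a :=
  (secAt_grassmannian φ.1 a).comp_morphAt
    (f := fun φ : extFlags S tV tW => φ.1) morphAt_val

/-- Images inherit sections. Intersections do so because the images have constant dimensions,
prescribed by `tW`. -/
theorem isMorphism_extFlagsMap :
    (extFlagVariety S tV tW).IsMorphism (baseVariety S tV tW) (extFlagsMap tV tW hS) := by
  rw [isMorphism_iff]
  intro φ
  refine MorphAt.prod (MorphAt.restrict ?_) (MorphAt.restrict ?_)
  · refine morphAt_grassmannian.2 fun a => ?_
    exact (secAt_extFlags φ a).comap (shortExact_atVertex hS a.2).1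
      (shortExact_atVertex hS a.2).2.1
      fun φ => (isFlag_imageFamily tV tW hS φ.2).dim a.1 a.2
  · exact morphAt_grassmannian.2 fun a => (secAt_extFlags φ a).map _

theorem exists_transport_left (hd : 0 < d) (y : S.X₁.flags tV × S.X₃.flags tW) (i : I) :
    ∃ g g' : S.X₁.flags tV × S.X₃.flags tW → S.X₁.space i →ₗ[ℂ] S.X₁.space i,
      (baseVariety S tV tW).RegAt y g ∧ (baseVariety S tV tW).RegAt y g' ∧ g y = LinearMap.id ∧
      g' y = LinearMap.id ∧ ∀ᶠ z in (baseVariety S tV tW).nhds y, ∀ r,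
        (∀ v ∈ y.1.1.1 (r, i), g z v ∈ z.1.1.1 (r, i)) ∧
          ∀ v, v ∈ z.1.1.1 (r, i) ↔ g' z v ∈ y.1.1.1 (r, i) :=
  let L : S.X₁.flags tV × S.X₃.flags tW → Fin d → Submodule ℂ (S.X₁.space i) :=
    fun z r => z.1.1.1 (r, i)
  exists_transport (S := baseVariety S tV tW) (x := y) L (fun z => z.1.2.monotone i) hd
    (fun z r hr => z.1.2.last r hr i) (fun z r => (z.1.2.dim r i).trans (y.1.2.dim r i).symm)
    fun r => secAt_left y (r, i)

theorem exists_transport_right (hd : 0 < d) (y : S.X₁.flags tV × S.X₃.flags tW) (i : I) :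
    ∃ g g' : S.X₁.flags tV × S.X₃.flags tW → S.X₃.space i →ₗ[ℂ] S.X₃.space i,
      (baseVariety S tV tW).RegAt y g ∧ (baseVariety S tV tW).RegAt y g' ∧ g y = LinearMap.id ∧
      g' y = LinearMap.id ∧ ∀ᶠ z in (baseVariety S tV tW).nhds y, ∀ r,
        (∀ v ∈ y.2.1.1 (r, i), g z v ∈ z.2.1.1 (r, i)) ∧
          ∀ v, v ∈ z.2.1.1 (r, i) ↔ g' z v ∈ y.2.1.1 (r, i) :=
  let L : S.X₁.flags tV × S.X₃.flags tW → Fin d → Submodule ℂ (S.X₃.space i) :=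
    fun z r => z.2.1.1 (r, i)
  exists_transport (S := baseVariety S tV tW) (x := y) L (fun z => z.2.2.monotone i) hd
    (fun z r hr => z.2.2.last r hr i) (fun z r => (z.2.2.dim r i).trans (y.2.2.dim r i).symm)
    fun r => secAt_right y (r, i)

theorem secAt_filteredMaps_flags (hd : 0 < d) (y : S.X₁.flags tV × S.X₃.flags tW) (i j : I) :
    (baseVariety S tV tW).SecAt y fun z =>
      filteredMaps (W := S.X₃.space i) (V := S.X₁.space j) (fun r => z.2.1.1 (r, i))
        (fun r => z.1.1.1 (r, j)) := by
  obtain ⟨g, _, h1, -, h2, -, h3⟩ := exists_transport_left hd y j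
  obtain ⟨_, h, -, h4, -, h5, h6⟩ := exists_transport_right hd y i
  exact secAt_filteredMaps h1 h4 h2 h5 (h3.mono fun z hz r => (hz r).1)
    (h6.mono fun z hz r v hv => ((hz r).2 v).1 hv)

theorem secAt_homFil (hd : 0 < d) (y : S.X₁.flags tV × S.X₃.flags tW) :
    (baseVariety S tV tW).SecAt y trivialLifts :=
  SecAt.pi fun i => secAt_filteredMaps_flags hd y i i

theorem secAt_arrowFil [∀ i j : I, Finite (i ⟶ j)] (hd : 0 < d)
    (y : S.X₁.flags tV × S.X₃.flags tW) :
    (baseVariety S tV tW).SecAt y fun z => arrowFil z.1.1.1 z.2.1.1 :=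
  SecAt.pi fun i => SecAt.pi fun j => SecAt.pi fun _ => secAt_filteredMaps_flags hd y i j

end Bundle

/-- Local regular frames of the quotients of `liftSpace` by `trivialLifts`, on an open set. -/
theorem exists_lift_frame [Fintype I] [∀ i j : I, Fintype (i ⟶ j)]
    {S : ShortComplex (QuiverRep.{u, v, w} I)} (hExt : ExtOneVanishes S.X₃ S.X₁)
    {d : ℕ} (hd : 0 < d) {tV tW : Fin d → I → ℕ} (y : S.X₁.flags tV × S.X₃.flags tW) :
    ∃ (O : Set (S.X₁.flags tV × S.X₃.flags tW)) (n : ℕ)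
      (k : S.X₁.flags tV × S.X₃.flags tW → Fin n → ∀ i, S.X₃.space i →ₗ[ℂ] S.X₁.space i),
      y ∈ O ∧ (baseVariety S tV tW).IsOpenSet O ∧
      (n : ℤ) = ∑ r : Fin d, ∑ t ∈ Finset.Ioi r, eulerForm I (flagTypeStep tW r)
        (flagTypeStep tV t) ∧
      ∀ z ∈ O, (∀ j, (baseVariety S tV tW).RegAt z fun z => k z j) ∧ (∀ j, k z j ∈ liftSpace z) ∧
        ∀ F ∈ liftSpace z, ∃! c : Fin n → ℂ,
          F - Fintype.linearCombination ℂ (k z) c ∈ trivialLifts z := by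
  obtain ⟨n, k, h1, h2, h3⟩ := exists_quotient_frame (S := baseVariety S tV tW) (x := y)
    hExt.differential_surjective
    (N := trivialLifts) (P := fun z => arrowFil z.1.1.1 z.2.1.1)
    (fun z => homFil_le z.1.2 z.2.2)
    (p := Module.finrank ℂ ((∀ i, S.X₃.space i →ₗ[ℂ] S.X₁.space i) ⧸ trivialLifts y))
    (q := Module.finrank ℂ ((∀ i j : I, (i ⟶ j) → S.X₃.space i →ₗ[ℂ] S.X₁.space j) ⧸
      arrowFil y.1.1.1 y.2.1.1))
    (fun z => by
      rw [← Nat.cast_inj (R := ℤ), finrank_quotient_homFil hd z.1.2 z.2.2,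
        finrank_quotient_homFil hd y.1.2 y.2.2])
    (fun z => by
      rw [← Nat.cast_inj (R := ℤ), finrank_quotient_arrowFil hd z.1.2 z.2.2,
        finrank_quotient_arrowFil hd y.1.2 y.2.2])
    (secAt_homFil hd y) (secAt_arrowFil hd y)
  -- Regularity of the frame at `y` spreads to nearby points, so that everything holds on one open
  -- set `O`.
  have h4 := (eventually_all.2 fun j => (h2 j).eventually).and h3
  obtain ⟨O, hO, hO', hy⟩ :=
    (@eventually_nhds_iff _ (baseVariety S tV tW).toTopologicalSpace _ _).1 h4
  refine ⟨O, n, k, hy, hO', ?_, hO⟩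
  rw [sum_eulerForm, ← finrank_quotient_homFil hd y.1.2 y.2.2,
    ← finrank_quotient_arrowFil hd y.1.2 y.2.2, ← h1]
  push_cast
  ring

end QuiverRep

/-! ### Local trivializations -/

namespace QuiverRep

open SpaceWithFunctions

variable {I : Type u} [Quiver.{v} I]

/-- A regular frame of the quotients of `liftSpace` by `trivialLifts` on a set trivializes the
bundle of flags there. -/
theorem exists_trivialization [Finite I]
    {S : ShortComplex (QuiverRep.{u, v, w} I)} (σ : S.Splitting) (hS : S.ShortExact)
    {d : ℕ} (hd : 0 < d) {tV tW : Fin d → I → ℕ} {O : Set (S.X₁.flags tV × S.X₃.flags tW)} {n : ℕ}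
    {k : S.X₁.flags tV × S.X₃.flags tW → Fin n → ∀ i, S.X₃.space i →ₗ[ℂ] S.X₁.space i}
    (hk : ∀ z ∈ O, ∀ j, (baseVariety S tV tW).RegAt z fun z => k z j)
    (hkl : ∀ z ∈ O, ∀ c, Fintype.linearCombination ℂ (k z) c ∈ liftSpace z)
    (hku : ∀ z ∈ O, ∀ F ∈ liftSpace z, ∃! c : Fin n → ℂ,
      F - Fintype.linearCombination ℂ (k z) c ∈ trivialLifts z) :
    ∃ e : (extFlagsMap tV tW hS ⁻¹' O : Set (extFlags S tV tW)) ≃ O × (Fin n → ℂ),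
      ((extFlagVariety S tV tW).restrict (extFlagsMap tV tW hS ⁻¹' O)).IsIsomorphism
        (((baseVariety S tV tW).restrict O).prod (affine (Fin n → ℂ))) e ∧
      (∀ x, ((e x).1 : S.X₁.flags tV × S.X₃.flags tW) = extFlagsMap tV tW hS x) ∧
      ∀ x z (hz : z ∈ O), extFlagsMap tV tW hS x.1 = z →
        twistFlag σ hS z ⟨_, hkl z hz (e x).2⟩ = x.1 := by
  have hex : ∀ x : (extFlagsMap tV tW hS ⁻¹' O : Set (extFlags S tV tW)), ∃ c,
      twistFlag σ hS (extFlagsMap tV tW hS x.1) ⟨_, hkl _ x.2 c⟩ = x.1 := by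
    intro x
    obtain ⟨F, hF⟩ := exists_twistFlag_eq σ hS hd x.1 rfl
    obtain ⟨c, hc, -⟩ := hku _ x.2 F.1 F.2
    refine ⟨c, ?_⟩
    exact ((twistFlag_eq_iff σ hS (F' := ⟨_, hkl _ x.2 c⟩)).2 hc).symm.trans hF
  choose c hc₀ using hex
  -- The base point is freed from the form `extFlagsMap x`, so that it can be replaced by an equal
  -- point despite the dependent types.
  have hc : ∀ x z (hz : z ∈ O), extFlagsMap tV tW hS x.1 = z →
      twistFlag σ hS z ⟨_, hkl z hz (c x)⟩ = x.1 := by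
    rintro x z hz rfl
    exact hc₀ x
  have huniq : ∀ z (hz : z ∈ O) c c', twistFlag σ hS z ⟨_, hkl z hz c⟩ =
      twistFlag σ hS z ⟨_, hkl z hz c'⟩ → c = c' := by
    intro z hz c c' h
    have h1 := (twistFlag_eq_iff σ hS).1 h
    refine (hku z hz _ (hkl z hz c)).unique ?_ h1
    rw [sub_self]
    exact zero_mem _
  let e : (extFlagsMap tV tW hS ⁻¹' O : Set (extFlags S tV tW)) ≃ O × (Fin n → ℂ) :=
    { toFun := fun x => (⟨extFlagsMap tV tW hS x.1, x.2⟩, c x)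
      invFun := fun q => ⟨twistFlag σ hS q.1.1 ⟨_, hkl _ q.1.2 q.2⟩, by
        rw [Set.mem_preimage, extFlagsMap_twistFlag]
        exact q.1.2⟩
      left_inv := fun x => Subtype.ext (hc x _ x.2 rfl)
      right_inv := by
        rintro ⟨⟨z, hz⟩, a⟩
        have h1 := extFlagsMap_twistFlag σ hS z ⟨_, hkl _ hz a⟩
        exact Prod.ext (Subtype.ext h1) (huniq z hz _ _ (hc ⟨_, _⟩ z hz h1)) }
  refine ⟨e, ⟨isMorphism_iff.2 fun x => ?_, isMorphism_iff.2 fun q => ?_⟩, fun x => rfl, hc⟩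
  · have hp : ((extFlagVariety S tV tW).restrict (extFlagsMap tV tW hS ⁻¹' O)).MorphAt
        (baseVariety S tV tW) (fun x => extFlagsMap tV tW hS x.1) x :=
      (isMorphism_iff.1 (isMorphism_extFlagsMap hS) x.1).comp morphAt_val
    refine MorphAt.prod (MorphAt.restrict hp) (morphAt_affine.2 ?_)
    have htw : ∀ x : (extFlagsMap tV tW hS ⁻¹' O : Set (extFlags S tV tW)),
        twist σ (Fintype.linearCombination ℂ (k (extFlagsMap tV tW hS x.1)) (c x))
          (extFlagsMap tV tW hS x.1).1.1.1 (extFlagsMap tV tW hS x.1).2.1.1 = x.1.1.1 := fun x =>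
      congrArg (fun φ : extFlags S tV tW => φ.1.1) (hc₀ x)
    choose g g' _ h2 _ _ h3 using exists_transport_left hd (extFlagsMap tV tW hS x.1)
    refine regAt_coordinates σ (c := c) (k := fun x => k (extFlagsMap tV tW hS x.1))
      (LV := fun x => (extFlagsMap tV tW hS x.1).1.1.1)
      (LW := fun x => (extFlagsMap tV tW hS x.1).2.1.1)
      (m := fun a => (tV + tW) a.1 a.2) (g := fun i x => g' i (extFlagsMap tV tW hS x.1))
      (fun j => RegAt.comp_morphAt (f := fun x : (extFlagsMap tV tW hS ⁻¹' O :
        Set (extFlags S tV tW)) => extFlagsMap tV tW hS x.1) (hk _ x.2 j) hp)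
      (fun y a => ?_) (fun a => ?_)
      (fun i => RegAt.comp_morphAt (f := fun x : (extFlagsMap tV tW hS ⁻¹' O :
        Set (extFlags S tV tW)) => extFlagsMap tV tW hS x.1) (h2 i) hp)
      (fun i => hp.1.eventually ((h3 i).mono fun y hy r => (hy r).2)) (fun a ha => ?_)
    · rw [htw]
      exact y.1.2.1.dim a.1 a.2
    · simp only [htw]
      exact (secAt_extFlags x.1 a).comp_morphAt morphAt_val
    · refine (hku _ x.2 0 (zero_mem _)).unique (y₁ := a) (y₂ := 0) ?_ ?_
      · rw [zero_sub]
        exact neg_mem ha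
      · rw [map_zero, sub_zero]
        exact zero_mem _
  · have hb : (((baseVariety S tV tW).restrict O).prod (affine (Fin n → ℂ))).MorphAt
        (baseVariety S tV tW) (fun q => q.1.1) q := morphAt_val.comp morphAt_fst
    -- The inverse is a morphism since the graph of a regular combination of the frame over the
    -- tautological flags has regular sections.
    refine MorphAt.restrict (MorphAt.restrict (morphAt_grassmannian.2 fun a => ?_))
    refine secAt_twist σ (F := fun q : O × (Fin n → ℂ) =>
      Fintype.linearCombination ℂ (k q.1.1) q.2) ?_
      (SecAt.comp_morphAt (f := fun q : O × (Fin n → ℂ) => q.1.1) (secAt_left q.1.1 a) hb)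
      (SecAt.comp_morphAt (f := fun q : O × (Fin n → ℂ) => q.1.1) (secAt_right q.1.1 a) hb)
    have hsnd : (((baseVariety S tV tW).restrict O).prod (affine (Fin n → ℂ))).RegAt q
        fun q => q.2 := morphAt_affine.1 morphAt_snd
    exact (RegAt.linearCombination fun j => RegAt.comp_morphAt
      (f := fun q : O × (Fin n → ℂ) => q.1.1) (hk _ q.1.2 j) hb).apply hsnd

end QuiverRep

/-! ### Assembling the vector bundle -/

theorem mainTheorem4 {I : Type u} [Quiver.{v} I] [Fintype I] [∀ i j : I, Fintype (i ⟶ j)]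
    (S : ShortComplex (QuiverRep.{u, v, w} I)) (hS : S.ShortExact)
    (hExt : QuiverRep.ExtOneVanishes S.X₃ S.X₁)
    {d : ℕ} (hd : 0 < d) (tV tW : Fin d → I → ℕ)
    (htV : QuiverRep.IsFlagType S.X₁ tV) (htW : QuiverRep.IsFlagType S.X₃ tW) :
    IsVectorBundleOfRank (QuiverRep.extFlagVariety S tV tW)
      ((QuiverRep.flagVariety S.X₁ tV).prod (QuiverRep.flagVariety S.X₃ tW))
      (QuiverRep.extFlagsMap tV tW hS)
      (∑ r : Fin d, ∑ t ∈ Finset.Ioi r, QuiverRep.eulerForm I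
        (QuiverRep.flagTypeStep tW r) (QuiverRep.flagTypeStep tV t)) := by
  obtain ⟨s, hs⟩ := hExt.exists_section hS
  let σ : S.Splitting := ShortComplex.Splitting.ofExactOfSection S hS.exact s hs hS.mono_f
  -- The vector space structure on every fibre comes from the quotient of lifts for one global
  -- splitting, so it does not depend on the local frames.
  choose ε hε using QuiverRep.exists_fibreEquiv (tV := tV) (tW := tW) σ hS hd
  refine ⟨QuiverRep.isMorphism_extFlagsMap hS, fun b => (ε b).addCommGroup,
    fun b => (ε b).module ℂ, fun y => ?_⟩
  obtain ⟨O, n, k, hy, hO, hn, hk⟩ := QuiverRep.exists_lift_frame hExt hd y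
  have hkl : ∀ z ∈ O, ∀ c, Fintype.linearCombination ℂ (k z) c ∈ QuiverRep.liftSpace z := by
    intro z hz c
    rw [Fintype.linearCombination_apply]
    exact sum_mem fun j _ => Submodule.smul_mem _ _ ((hk z hz).2.1 j)
  obtain ⟨e, he, he1, he2⟩ := QuiverRep.exists_trivialization σ hS hd (fun z hz => (hk z hz).1) hkl
    fun z hz => (hk z hz).2.2
  refine ⟨O, n, e, hy, hO, hn, he, he1, fun b hb => ?_⟩
  -- In the fibre over `b` the trivialization followed by the injective linear map `κ` is the
  -- identification with the quotient of lifts; linearity of the latter gives that of the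
  -- trivialization.
  let κ : (Fin n → ℂ) →ₗ[ℂ] (QuiverRep.liftSpace b ⧸
      (QuiverRep.trivialLifts b).submoduleOf (QuiverRep.liftSpace b)) :=
    Submodule.mkQ _ ∘ₗ (Fintype.linearCombination ℂ (k b)).codRestrict _ (hkl b hb)
  have hκ : Function.Injective κ := by
    intro c c' h
    have h1 := (Submodule.Quotient.eq _).1 h
    refine ((hk b hb).2.2 _ (hkl b hb c)).unique ?_ h1
    rw [sub_self]
    exact zero_mem _
  have key : ∀ x, κ (e ⟨x.1, show QuiverRep.extFlagsMap tV tW hS x.1 ∈ O from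
      x.2.symm ▸ hb⟩).2 = ε b x := fun x => (hε b x _ (he2 _ b hb x.2)).symm
  let _ := (ε b).addCommGroup
  let _ := (ε b).module ℂ
  refine ⟨fun x x' => hκ ?_, fun a x => hκ ?_⟩
  · rw [map_add, key, key, key]
    exact ((ε b).linearEquiv ℂ).map_add x x'
  · rw [map_smul, key, key]
    exact ((ε b).linearEquiv ℂ).map_smul a x
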